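/- **Network.** A network is a finite directed multigraph whose edges are credit-based-shaper (CBS) output queues $(u,v,p)$: the queue of priority $p$ (larger means higher) at node $u$ feeding the physical link $(u,v)$. All links have capacity $C>0$; processing and propagation delays are zero and forwarding is store-and-forward. Each queue $q$ is pre-configured with an idle slope $idSl^q>0$ (the idle slopes at one port sum to at most $C$), a maximum packet size $L^q$ and a maximum per-hop delay budget $\overline D^q\ge 0$; $L_{BE}$ is the maximum best-effort packet size of a link. Put $sdSl^q=idSl^q-C$, $c_{min}^q=sdSl^q L^q/C$ and $$c_{max}^{q}=idSl^{q}\,\frac{\sum_{i>p}c_{min}^{u,v,i}-L^{u,v,<p}}{\sum_{i>p}idSl^{u,v,i}-C}\qquad(q=(u,v,p)),$$ where $i$ ranges over the higher-priority CBS queues of the port and $L^{u,v,<p}$ is the maximum of $L_{BE}$ and of the $L$ of the lower-priority CBS queues of the port. **CBS rules.** A port transmits one packet at a time, non-preemptively; each queue is FIFO; a packet may start only if the credit of its queue is $\ge 0$ and no higher-priority queue of the port has a waiting packet and credit $\ge 0$; best-effort packets start only if no CBS queue of the port has a waiting packet and credit $\ge0$; the link does not idle while some CBS queue has a waiting packet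 and credit $\ge 0$. The credit is initially $0$, changes with slope $sdSl$ during a transmission of the queue and with slope $idSl$ while packets of the queue wait or the credit is negative; a positive credit is reset to $0$ when the queue is empty. Best-effort traffic is otherwise arbitrary. **Flows.** A flow $f$ has a sending interval $\mathit{CMI}_f>0$, at most $\mathit{MIF}_f$ packets in every (half-open) time interval of length $\mathit{CMI}_f$, packets of at most $\mathit{MFS}_f$ bytes and at least $l_f\ge 0$ bits (with $l_f\le 8\,\mathit{MFS}_f$), and follows a path (or, for several listeners, a tree of paths) of queues $q$ with $8\,\mathit{MFS}_f\le L^q$. Let $\Phi_f^q$ be the queues on its path before $q$, and $$\alpha_f(t)=8\,\mathit{MFS}_f\,\mathit{MIF}_f\Big\lceil \frac{t}{\mathit{CMI}_f}\Big\rceil,\qquad \Delta d_f^q=\sum_{q'\in\Phi_f^q}\overline D^{q'}-|\Phi_f^q|\frac{l_f}{C}.$$ **Curves.** For a set $F$ of reserved flows and a queue $q=(u,v,p)$ let $F_0,F_l,F_{l,q'}$ be the flows of $F$ through $q$ that are emitted directly into $q$, that arrive over the input link $l$, and that arrive over $l$ from the queue $q'$. Let $\beta^q(t)=idSl^q\,[t-c_{max}^q/idSl^q]^+$,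 $\sigma_l(t)=L^q+Ct$, $\sigma_{CBS}^{q'}(t)=idSl^{q'}\big(t+\frac{c_{max}^{q'}-c_{min}^{q'}}{idSl^{q'}}\big)+L^{q'}$ and $$\alpha^q_F(t)=\sum_{f\in F_0}\alpha_f(t)+\sum_{l}\min\{\alpha_l^q(t),\sigma_l(t)\},$$ with $l$ ranging over the links into $u$, where in the basic version $\alpha_l^q(t)=\sum_{f\in F_l}\alpha_f(t+\Delta d_f^q)$, and in the improved version $\alpha_l^q(t)=\sum_{q'}\min\big\{\sum_{f\in F_{l,q'}}\alpha_f(t+\Delta d_f^q),\ \sigma_{CBS}^{q'}(t)\big\}$ with $q'$ ranging over the CBS queues feeding $l$. Let $h(\alpha,\beta)=\sup_{t\ge0}\inf\{d\ge0:\alpha(t)\le\beta(t+d)\}\in[0,\infty]$. **Protocol (RRP).** Flows $f_1,\dots,f_n$ are reserved one after the other, at times $t_1\le\dots\le t_n$; with $F_k=\{f_1,\dots,f_k\}$, flow $f_k$ is accepted only if $h(\alpha^q_{F_k},\beta^q)\le\overline D^q$ for every queue $q$ on its own route. Packets of a flow are emitted (at times $\ge0$) only after its reservation. **Theorem.** Fix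 the basic or the improved version of the arrival curve, and let all reservations be accepted with it. In every evolution of the network that obeys the rules above, for every $k\le n$ and every queue $q$, let $D^q_k$ be the worst-case delay of $q$ while exactly $F_k$ is reserved: the supremum, over all packets arriving at $q$ at such a time, of the time from arrival to departure of the last bit ($\infty$ for a packet that never departs). Then $$D^q_k\le h(\alpha^q_{F_k},\beta^q)\qquad\text{and}\qquad D^q_k\le\overline D^q .$$ In particular, the guarantees $\overline D^q$ remain valid when further flows are admitted. Moreover, if the $k$-th flow does not traverse $q$, then $\alpha^q_{F_k}=\alpha^q_{F_{k-1}}$, so its reservation leaves the bound at $q$ unchanged. -/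

import Mathlib

open scoped ENNReal

namespace RRP

/-- A credit-based-shaper (CBS) output queue `(u, v, p)`: the queue of priority `p` at the output
port of node `u` that feeds the physical link `(u, v)`. A larger `p` is a higher priority. -/
structure Queue (V : Type*) (Q : ℕ) where
  src : V
  dst : V
  prio : Fin Q
  deriving DecidableEq

variable {V : Type*} [DecidableEq V] {Q : ℕ}

/-- The physical link fed by a queue. -/
def Queue.link (q : Queue V Q) : V × V := (q.src, q.dst)

/-- A pre-configured network: a finite directed multigraph whose edges are the CBS queues.
Data is measured in bits. -/
structure Network (V : Type*) [DecidableEq V] (Q : ℕ) where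
  /-- the CBS queues of the network -/
  E : Finset (Queue V Q)
  /-- the capacity of every physical link -/
  C : ℝ
  C_pos : 0 < C
  /-- the configured idle slope of a queue -/
  idSl : Queue V Q → ℝ
  idSl_pos : ∀ q ∈ E, 0 < idSl q
  /-- at each port, the idle slopes together do not exceed the link capacity -/
  idSl_sum_le : ∀ l : V × V, ∑ q ∈ E with q.link = l, idSl q ≤ C
  /-- the maximum packet size at a queue -/
  L : Queue V Q → ℝ
  L_nonneg : ∀ q ∈ E, 0 ≤ L q
  /-- the maximum size of a best-effort packet on a link -/
  Lbe : V × V → ℝ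
  Lbe_nonneg : ∀ l, 0 ≤ Lbe l
  /-- the pre-configured maximum per-hop delay (delay budget) of a queue -/
  Dmax : Queue V Q → ℝ
  Dmax_nonneg : ∀ q ∈ E, 0 ≤ Dmax q

/-- Rate-latency curve `R * [t - T]⁺`. -/
def rateLatency (R T t : ℝ) : ℝ := R * max (t - T) 0

/-- Maximum horizontal distance `sup_{t ≥ 0} inf {d ≥ 0 | f t ≤ g (t + d)}`; it is `∞` when the
curves drift apart. -/
noncomputable def horizontalDistance (f g : ℝ → ℝ) : ℝ≥0∞ :=
  ⨆ (t : ℝ) (_ : 0 ≤ t), ⨅ (d : ℝ) (_ : 0 ≤ d ∧ f t ≤ g (t + d)), ENNReal.ofReal d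

namespace Network

variable (N : Network V Q)

/-- The CBS queues of higher priority at the same port. -/
def higher (q : Queue V Q) : Finset (Queue V Q) :=
  {i ∈ N.E | i.link = q.link ∧ q.prio < i.prio}

/-- The CBS queues of lower priority at the same port. -/
def lower (q : Queue V Q) : Finset (Queue V Q) :=
  {i ∈ N.E | i.link = q.link ∧ i.prio < q.prio}

/-- The maximum size of a packet of lower priority (best effort included) at the same port. -/
noncomputable def Llow (q : Queue V Q) : ℝ := (N.lower q).fold max (N.Lbe q.link) N.L

/-- Send slope. -/
noncomputable def sdSl (q : Queue V Q) : ℝ := N.idSl q - N.C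

/-- The minimum credit. -/
noncomputable def cmin (q : Queue V Q) : ℝ := N.sdSl q * (N.L q / N.C)

/-- The maximum credit. -/
noncomputable def cmax (q : Queue V Q) : ℝ :=
  N.idSl q * ((∑ i ∈ N.higher q, N.cmin i - N.Llow q) / (∑ i ∈ N.higher q, N.idSl i - N.C))

/-- The CBS service curve. -/
noncomputable def serviceCurve (q : Queue V Q) : ℝ → ℝ :=
  rateLatency (N.idSl q) (N.cmax q / N.idSl q)

/-- The shaping curve of an input link, for the traffic that it delivers to queue `q`. -/
noncomputable def linkShaping (q : Queue V Q) (t : ℝ) : ℝ := N.L q + N.C * t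

/-- The CBS shaping curve of queue `q`. -/
noncomputable def cbsShaping (q : Queue V Q) (t : ℝ) : ℝ :=
  N.idSl q * (t + (N.cmax q - N.cmin q) / N.idSl q) + N.L q

/-- The physical links that enter the node `u`. -/
def inLinks (u : V) : Finset (V × V) := {l ∈ N.E.image Queue.link | l.2 = u}

/-- The CBS queues that feed the physical link `l`. -/
def linkQueues (l : V × V) : Finset (Queue V Q) := {q ∈ N.E | q.link = l}

end Network

/-- A flow: its traffic specification and its route, which is a path from the talker or, for
several listeners, a tree of paths. -/
structure Flow (N : Network V Q) where
  /-- sending interval -/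
  CMI : ℝ
  CMI_pos : 0 < CMI
  /-- maximum number of packets per interval -/
  MIF : ℕ
  /-- maximum packet size, in bytes -/
  MFS : ℕ
  /-- minimum packet size, in bits -/
  l : ℝ
  l_nonneg : 0 ≤ l
  l_le : l ≤ 8 * MFS
  /-- the end station that emits the flow -/
  talker : V
  /-- the queues that the flow traverses -/
  queues : Finset (Queue V Q)
  queues_sub : queues ⊆ N.E
  /-- the queues on the path of the flow before a given queue, in the order of traversal -/
  before : Queue V Q → List (Queue V Q)
  route : ∀ q ∈ queues, (before q = [] ∧ q.src = talker) ∨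
    ∃ q' ∈ queues, q'.dst = q.src ∧ before q = before q' ++ [q']
  size_le : ∀ q ∈ queues, (8 * MFS : ℝ) ≤ N.L q

namespace Flow

variable {N : Network V Q} (f : Flow N)

/-- The queue that the flow traverses just before `q`, if `q` is not its first queue. -/
def pred (q : Queue V Q) : Option (Queue V Q) := (f.before q).getLast?

/-- The arrival curve of the flow at its source. -/
noncomputable def curve (t : ℝ) : ℝ := (f.MFS * f.MIF * 8) * (⌈t / f.CMI⌉ : ℝ)

/-- The accumulated maximum latency before `q`: the sum of the delay budgets. -/
noncomputable def accMax (q : Queue V Q) : ℝ := ((f.before q).map N.Dmax).sum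

/-- The accumulated minimum latency before `q`. -/
noncomputable def accMin (q : Queue V Q) : ℝ := (f.before q).length * (f.l / N.C)

/-- The accumulated delay difference before `q`. -/
noncomputable def deltaD (q : Queue V Q) : ℝ := f.accMax q - f.accMin q

end Flow

/-- A sequence of `n` reservations: flow `k` is reserved at time `time k`. -/
structure Reservations (N : Network V Q) (n : ℕ) where
  flow : Fin n → Flow N
  time : Fin n → ℝ
  time_mono : Monotone time

namespace Reservations

variable {N : Network V Q} {n : ℕ} (S : Reservations N n)

/-- The first `k` flows. -/
def first (n k : ℕ) : Finset (Fin n) := {i | i.val < k}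

/-- The flows of `F` that start at queue `q`. -/
noncomputable def localFlows (F : Finset (Fin n)) (q : Queue V Q) : Finset (Fin n) :=
  {i ∈ F | q ∈ (S.flow i).queues ∧ (S.flow i).pred q = none}

/-- The flows of `F` that reach queue `q` directly from queue `q'`. -/
noncomputable def flowsFrom (F : Finset (Fin n)) (q q' : Queue V Q) : Finset (Fin n) :=
  {i ∈ F | q ∈ (S.flow i).queues ∧ (S.flow i).pred q = some q'}

/-- The flows of `F` that reach queue `q` over the input link `l`. -/
noncomputable def flowsFromLink (F : Finset (Fin n)) (q : Queue V Q) (l : V × V) :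
    Finset (Fin n) :=
  {i ∈ F | q ∈ (S.flow i).queues ∧ ((S.flow i).pred q).map Queue.link = some l}

/-- The curve of the flows of `F` that are emitted directly into `q`; no link precedes them. -/
noncomputable def localCurve (F : Finset (Fin n)) (q : Queue V Q) (t : ℝ) : ℝ :=
  ∑ i ∈ S.localFlows F q, (S.flow i).curve (t + (S.flow i).deltaD q)

/-- The queue arrival curve when the flows of `F` are reserved: per input link, the flow
curves are summed up and capped by the link shaping curve. -/
noncomputable def arrivalCurve (F : Finset (Fin n)) (q : Queue V Q) (t : ℝ) : ℝ :=
  S.localCurve F q t + ∑ l ∈ N.inLinks q.src,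
    min (∑ i ∈ S.flowsFromLink F q l, (S.flow i).curve (t + (S.flow i).deltaD q))
      (N.linkShaping q t)

/-- The improved queue arrival curve: in addition, the flows that come from the same preceding
queue are capped by the CBS shaping curve of that queue. -/
noncomputable def improvedArrivalCurve (F : Finset (Fin n)) (q : Queue V Q) (t : ℝ) : ℝ :=
  S.localCurve F q t + ∑ l ∈ N.inLinks q.src,
    min (∑ q' ∈ N.linkQueues l,
        min (∑ i ∈ S.flowsFrom F q q', (S.flow i).curve (t + (S.flow i).deltaD q))
          (N.cbsShaping q' t))
      (N.linkShaping q t)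

/-- The admission control, run with the queue arrival curves `α`: each new flow is accepted only
if, at every queue of its own route, the delay bound that includes the new flow does not
exceed the delay budget. -/
def Admitted (α : Finset (Fin n) → Queue V Q → ℝ → ℝ) : Prop :=
  ∀ k : Fin n, ∀ q ∈ (S.flow k).queues,
    horizontalDistance (α (first n (k + 1)) q) (N.serviceCurve q) ≤ ENNReal.ofReal (N.Dmax q)

/-- The flows that have been reserved by time `t`. -/
noncomputable def reserved (t : ℝ) : Finset (Fin n) := {i | S.time i ≤ t}

end Reservations

/-- The raw data of an evolution of the network. The packets of the reserved flows are the elements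
of `P`; a best-effort transmission is a pair of its start time and its packet size. -/
structure Trace {N : Network V Q} {n : ℕ} (S : Reservations N n) (P : Type*) where
  /-- the flow of a packet -/
  flowOf : P → Fin n
  /-- the size of a packet, in bits -/
  size : P → ℝ
  /-- the time at which the talker puts the packet into its first queue(s) -/
  emit : P → ℝ
  /-- the time, if any, at which the transmission of the packet out of a queue starts -/
  start : P → Queue V Q → Option ℝ
  /-- the best-effort transmissions on a link -/
  be : V × V → Set (ℝ × ℝ)
  /-- the credit of a queue -/
  credit : Queue V Q → ℝ → ℝ

namespace Trace

variable {N : Network V Q} {n : ℕ} {S : Reservations N n} {P : Type*} (X : Trace S P)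

/-- The last bit of packet `x` leaves queue `q` at time `d`. -/
def Departs (x : P) (q : Queue V Q) (d : ℝ) : Prop :=
  ∃ s, X.start x q = some s ∧ d = s + X.size x / N.C

/-- Packet `x` arrives at queue `q` at time `a` (store-and-forward: when its last bit has left the
preceding queue). -/
def Arrives (x : P) (q : Queue V Q) (a : ℝ) : Prop :=
  q ∈ (S.flow (X.flowOf x)).queues ∧
    (((S.flow (X.flowOf x)).pred q = none ∧ a = X.emit x) ∨
      ∃ q', (S.flow (X.flowOf x)).pred q = some q' ∧ X.Departs x q' a)

/-- At time `t`, a packet is in queue `q` whose transmission has not started. -/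
def Waiting (q : Queue V Q) (t : ℝ) : Prop :=
  ∃ x a, X.Arrives x q a ∧ a ≤ t ∧ ∀ s, X.start x q = some s → t < s

/-- At time `t`, a packet of queue `q` is under transmission. -/
def Sending (q : Queue V Q) (t : ℝ) : Prop :=
  ∃ x s, X.start x q = some s ∧ s ≤ t ∧ t < s + X.size x / N.C

/-- At time `t`, queue `q` is empty. -/
def Empty (q : Queue V Q) (t : ℝ) : Prop := ¬ X.Waiting q t ∧ ¬ X.Sending q t

/-- At time `t`, queue `q` has a packet that is eligible for transmission. -/
def Eligible (q : Queue V Q) (t : ℝ) : Prop := X.Waiting q t ∧ 0 ≤ X.credit q t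

/-- At time `t`, a packet is under transmission on link `l`. -/
def Busy (l : V × V) (t : ℝ) : Prop :=
  (∃ q ∈ N.E, q.link = l ∧ X.Sending q t) ∨ ∃ b ∈ X.be l, b.1 ≤ t ∧ t < b.1 + b.2 / N.C

/-- The trace obeys the traffic specifications of the flows and the rules of the CBS network. -/
structure IsRun : Prop where
  -- packets of the flows
  size_pos : ∀ x, 0 < X.size x
  size_ge : ∀ x, (S.flow (X.flowOf x)).l ≤ X.size x
  size_le : ∀ x, X.size x ≤ 8 * (S.flow (X.flowOf x)).MFS
  emit_nonneg : ∀ x, 0 ≤ X.emit x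
  emit_reserved : ∀ x, S.time (X.flowOf x) ≤ X.emit x
  /-- a flow emits at most `MIF` packets in each time interval of length `CMI` -/
  emit_interval : ∀ (i : Fin n) (s : ℝ),
    {x | X.flowOf x = i ∧ s ≤ X.emit x ∧ X.emit x < s + (S.flow i).CMI}.encard ≤ (S.flow i).MIF
  -- best-effort packets
  be_size : ∀ l, ∀ b ∈ X.be l, 0 < b.2 ∧ b.2 ≤ N.Lbe l
  -- queues and links
  start_arrived : ∀ x q s, X.start x q = some s → ∃ a, X.Arrives x q a ∧ a ≤ s
  fifo : ∀ x y q a b t, X.Arrives x q a → X.Arrives y q b → a < b → X.start y q = some t →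
    ∃ s, X.start x q = some s ∧ s < t
  /-- a link transmits one packet at a time, without preemption -/
  exclusive : ∀ x y q q' s t, q.link = q'.link → (x, q) ≠ (y, q') →
    X.start x q = some s → X.start y q' = some t →
    s + X.size x / N.C ≤ t ∨ t + X.size y / N.C ≤ s
  exclusive_be : ∀ x q s, ∀ b ∈ X.be q.link, X.start x q = some s →
    s + X.size x / N.C ≤ b.1 ∨ b.1 + b.2 / N.C ≤ s
  exclusive_be_be : ∀ l, ∀ b ∈ X.be l, ∀ b' ∈ X.be l, b ≠ b' →
    b.1 + b.2 / N.C ≤ b'.1 ∨ b'.1 + b'.2 / N.C ≤ b.1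
  -- transmission selection
  start_credit : ∀ x q s, X.start x q = some s → 0 ≤ X.credit q s
  start_priority : ∀ x q s, X.start x q = some s → ∀ q' ∈ N.higher q, ¬ X.Eligible q' s
  be_priority : ∀ l, ∀ b ∈ X.be l, ∀ q ∈ N.E, q.link = l → ¬ X.Eligible q b.1
  /-- the link does not stay idle while a packet is eligible -/
  work_conserving : ∀ q ∈ N.E, ∀ t, X.Eligible q t → X.Busy q.link t
  -- evolution of the credit
  credit_init : ∀ q ∈ N.E, ∀ t ≤ 0, X.credit q t = 0
  /-- during a transmission the credit changes with the send slope -/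
  credit_sending : ∀ q ∈ N.E, ∀ s t, s < t → (∀ r ∈ Set.Ico s t, X.Sending q r) →
    ¬ X.Empty q t → X.credit q t = X.credit q s + N.sdSl q * (t - s)
  /-- a positive credit is reset to zero if the queue is empty when the transmission ends -/
  credit_reset : ∀ q ∈ N.E, ∀ s t, s < t → (∀ r ∈ Set.Ico s t, X.Sending q r) →
    X.Empty q t → X.credit q t = min 0 (X.credit q s + N.sdSl q * (t - s))
  /-- while packets wait, the credit increases with the idle slope -/
  credit_waiting : ∀ q ∈ N.E, ∀ s t, s < t →
    (∀ r ∈ Set.Ico s t, X.Waiting q r ∧ ¬ X.Sending q r) →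
    X.credit q t = X.credit q s + N.idSl q * (t - s)
  /-- while the queue is empty, a negative credit increases with the idle slope up to zero -/
  credit_empty : ∀ q ∈ N.E, ∀ s t, s < t → (∀ r ∈ Set.Ico s t, X.Empty q r) →
    X.credit q t = min 0 (X.credit q s + N.idSl q * (t - s))

/-- The delay in queue `q` of packet `x` that arrives at time `a`, up to the departure of its last
bit; it is `∞` if the packet never departs. -/
noncomputable def delay (x : P) (q : Queue V Q) (a : ℝ) : ℝ≥0∞ :=
  ⨅ (d : ℝ) (_ : X.Departs x q d), ENNReal.ofReal (d - a)

/-- The worst-case delay in queue `q` while the first `k` flows are reserved: the supremum of the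
delays of all packets that arrive at `q` at a time at which these are the reserved flows. -/
noncomputable def worstDelay (k : ℕ) (q : Queue V Q) : ℝ≥0∞ :=
  ⨆ (x : P) (a : ℝ) (_ : X.Arrives x q a ∧ S.reserved a = Reservations.first n k), X.delay x q a

end Trace

end RRP

/-!
The proof is a chain of deterministic bounds on every single evolution of the network.

*Credit.* Between two consecutive events of a queue its state is constant and its credit follows a
single rule, and there are finitely many events before any time, so statements about the credit are
proved from event to event (`IsRun.rel_of_steps`). The service that a queue receives during an
interval is the reserved service `idSl * t` minus the change of its credit, up to credit that is
lost by resets and by saturation at zero (`IsRun.ledger_antitone`); nothing is lost while the queue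
is not empty (`IsRun.le_ledger_of_not_empty`). The credit is at least `cmin` because a transmission
starts with nonnegative credit. It is at most `cmax` because of a potential, `credit q` plus
`idSl q / (C - A)` times the credits of the higher priorities, `A` being the sum of their idle
slopes: it does not grow while one of these queues transmits, and any other transmission starts when
the potential is nonpositive and takes at most `Llow / C` (`IsRun.potential_le`).

*Service and shaping.* Counting from the last loss of credit, the queue therefore transmits at least
`idSl * t - cmax`, which together with FIFO gives the service curve (`IsRun.exists_departs_le`),
and it never transmits more than `idSl * t + cmax - cmin`, which gives the CBS shaping curve.

*Arrivals.* If the previous hops kept their delay budgets, a flow reaches a queue with its source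
curve stretched by the accumulated delay difference, and the sum of the flows is also subject to the
two shaping curves (`IsRun.sum_size_le_improvedArrivalCurve`). The basic arrival curve dominates the
improved one, so this covers both versions. Flows without packets must not contribute a negative
amount to the curve; this follows from the admission control (`Reservations.deltaD_nonneg`).

*Causality.* Budgets may depend on each other cyclically, but packets reach a queue strictly after
they reached the previous one. Hence the budgets are shown to hold by induction on the arrival times
(`IsRun.exists_departs_le_Dmax`). At each time, the bound at a queue equals the one checked for the
last reserved flow that traverses it, since later reservations do not change the curve there.
-/

namespace RRP

/-! ### Steps between events, disjoint intervals -/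

/-- A transitive relation between reals that holds across every interval without an event in its
interior holds across every interval that contains finitely many events. -/
theorem rel_of_forall_eventless {Ev : Set ℝ} {R : ℝ → ℝ → Prop}
    (htrans : ∀ u v w, R u v → R v w → R u w) {s t : ℝ} (hst : s < t)
    (hfin : (Ev ∩ Set.Ioo s t).Finite)
    (hstep : ∀ u v, s ≤ u → u < v → v ≤ t → (∀ e ∈ Ev, ¬ (u < e ∧ e < v)) → R u v) :
    R s t := by
  obtain ⟨k, hk⟩ : ∃ k, (Ev ∩ Set.Ioo s t).ncard = k := ⟨_, rfl⟩
  induction k using Nat.strong_induction_on generalizing s t with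
  | _ k ih =>
    by_cases hE : ∀ e ∈ Ev, ¬ (s < e ∧ e < t)
    · exact hstep s t le_rfl hst le_rfl hE
    · push Not at hE
      obtain ⟨e, heE, hse, het⟩ := hE
      have h1 : Ev ∩ Set.Ioo s e ⊂ Ev ∩ Set.Ioo s t :=
        ⟨fun y hy => ⟨hy.1, hy.2.1, hy.2.2.trans het⟩,
          fun h => lt_irrefl e (h ⟨heE, hse, het⟩).2.2⟩
      have h2 : Ev ∩ Set.Ioo e t ⊂ Ev ∩ Set.Ioo s t :=
        ⟨fun y hy => ⟨hy.1, hse.trans hy.2.1, hy.2.2⟩,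
          fun h => lt_irrefl e (h ⟨heE, hse, het⟩).2.1⟩
      refine htrans s e t ?_ ?_
      · exact ih _ (hk ▸ Set.ncard_lt_ncard h1 hfin) hse (hfin.subset h1.1)
          (fun u v hu huv hv => hstep u v hu huv (hv.trans het.le)) rfl
      · exact ih _ (hk ▸ Set.ncard_lt_ncard h2 hfin) het (hfin.subset h2.1)
          (fun u v hu huv hv => hstep u v (hse.le.trans hu) huv hv) rfl

/-- Disjoint intervals that all end within `[s, t]`: only the first one can reach back beyond
`s`, so that together they are at most `t - s` plus the length `W` of one interval. -/
theorem sum_length_le_of_disjoint {ι : Type*} (Y : Finset ι) (σ w : ι → ℝ) {s W : ℝ}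
    (hW : 0 ≤ W) (hw : ∀ i ∈ Y, 0 < w i ∧ w i ≤ W)
    (hdisj : ∀ i ∈ Y, ∀ j ∈ Y, i ≠ j → σ i + w i ≤ σ j ∨ σ j + w j ≤ σ i) {t : ℝ} (hst : s ≤ t)
    (hY : ∀ i ∈ Y, s ≤ σ i + w i ∧ σ i + w i ≤ t) : ∑ i ∈ Y, w i ≤ (t - s) + W := by
  classical
  induction Y using Finset.induction_on_max_value σ generalizing t with
  | empty => simp only [Finset.sum_empty]; linarith
  | insert m Y hm hmax ih =>
    rw [Finset.sum_insert hm]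
    obtain ⟨hsm, hmt⟩ := hY m (Finset.mem_insert_self m Y)
    obtain ⟨hw0, hwW⟩ := hw m (Finset.mem_insert_self m Y)
    have hend : ∀ i ∈ Y, σ i + w i ≤ σ m := fun i hi => by
      rcases hdisj i (Finset.mem_insert_of_mem hi) m (Finset.mem_insert_self m Y)
        (fun h => hm (h ▸ hi)) with h | h
      · exact h
      · linarith [hmax i hi]
    rcases Y.eq_empty_or_nonempty with rfl | ⟨j, hj⟩
    · simp only [Finset.sum_empty]; linarith
    · have := ih (fun i hi => hw i (Finset.mem_insert_of_mem hi))
        (fun i hi j hj => hdisj i (Finset.mem_insert_of_mem hi) j (Finset.mem_insert_of_mem hj))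
        ((hY j (Finset.mem_insert_of_mem hj)).1.trans (hend j hj))
        (fun i hi => ⟨(hY i (Finset.mem_insert_of_mem hi)).1, hend i hi⟩)
      linarith

variable {V : Type*} [DecidableEq V] {Q : ℕ} {N : Network V Q} {n : ℕ} {S : Reservations N n}
  {P : Type*} {X : Trace S P}

/-! ### Routes and arrival times -/

namespace Flow

theorem pred_cases (f : Flow N) {q : Queue V Q} (hq : q ∈ f.queues) :
    (f.before q = [] ∧ f.pred q = none) ∨
      ∃ q' ∈ f.queues, q'.dst = q.src ∧ f.before q = f.before q' ++ [q'] ∧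
        f.pred q = some q' := by
  rcases f.route q hq with ⟨h, -⟩ | ⟨q', hq', hd, hb⟩
  · exact Or.inl ⟨h, by simp [pred, h]⟩
  · exact Or.inr ⟨q', hq', hd, hb, by simp [pred, hb]⟩

theorem of_pred_eq_some (f : Flow N) {q q' : Queue V Q} (hq : q ∈ f.queues)
    (h : f.pred q = some q') :
    q' ∈ f.queues ∧ q'.dst = q.src ∧ f.before q = f.before q' ++ [q'] := by
  rcases f.pred_cases hq with ⟨-, h'⟩ | ⟨p, hp, hd, hb, h'⟩
  · simp [h'] at h
  · obtain rfl : p = q' := by simpa [h'] using h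
    exact ⟨hp, hd, hb⟩

end Flow

namespace Trace

theorem Departs.unique {x : P} {q : Queue V Q} {d e : ℝ} (hd : X.Departs x q d)
    (he : X.Departs x q e) : d = e := by
  obtain ⟨s, hs, rfl⟩ := hd
  obtain ⟨s', hs', rfl⟩ := he
  obtain rfl : s = s' := Option.some.inj (hs.symm.trans hs')
  rfl

theorem Arrives.unique {x : P} {q : Queue V Q} {a b : ℝ} (ha : X.Arrives x q a)
    (hb : X.Arrives x q b) : a = b := by
  obtain ⟨-, ⟨h, rfl⟩ | ⟨p, h, hd⟩⟩ := ha <;> obtain ⟨-, ⟨h', rfl⟩ | ⟨p', h', hd'⟩⟩ := hb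
  · rfl
  · simp [h] at h'
  · simp [h] at h'
  · obtain rfl : p = p' := Option.some.inj (h.symm.trans h')
    exact hd.unique hd'

/-- The times at which the state of queue `q` may change. -/
def events (X : Trace S P) (q : Queue V Q) : Set ℝ :=
  {e | ∃ x, X.Arrives x q e ∨ X.start x q = some e ∨ X.Departs x q e}

theorem not_sending_of_eventless {q : Queue V Q} {u v : ℝ}
    (hev : ∀ e ∈ X.events q, ¬ (u < e ∧ e < v)) (h : ¬ X.Sending q u) :
    ∀ r ∈ Set.Ico u v, ¬ X.Sending q r := by
  rintro r ⟨hur, hrv⟩ ⟨y, s, hs, hsr, hre⟩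
  rcases le_or_gt s u with hsu | hsu
  · exact h ⟨y, s, hs, hsu, by linarith⟩
  · exact hev s ⟨y, Or.inr (Or.inl hs)⟩ ⟨hsu, by linarith⟩

/-- Between two consecutive events, the state of a queue does not change. -/
theorem state_of_eventless (X : Trace S P) {q : Queue V Q} {u v : ℝ}
    (hev : ∀ e ∈ X.events q, ¬ (u < e ∧ e < v)) :
    (∃ x s, X.start x q = some s ∧ s ≤ u ∧ u < s + X.size x / N.C ∧ v ≤ s + X.size x / N.C) ∨
      (∀ r ∈ Set.Ico u v, X.Waiting q r ∧ ¬ X.Sending q r) ∨ ∀ r ∈ Set.Ico u v, X.Empty q r := by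
  by_cases hs : X.Sending q u
  · obtain ⟨x, s, hs, hsu, hue⟩ := hs
    refine Or.inl ⟨x, s, hs, hsu, hue, ?_⟩
    by_contra! h
    exact hev _ ⟨x, Or.inr (Or.inr ⟨s, hs, rfl⟩)⟩ ⟨hue, h⟩
  have hns := not_sending_of_eventless hev hs
  by_cases hw : X.Waiting q u
  · obtain ⟨x, a, ha, hau, hx⟩ := hw
    refine Or.inr (Or.inl fun r hr => ⟨⟨x, a, ha, hau.trans hr.1, fun s hs => ?_⟩, hns r hr⟩)
    by_contra! h
    exact hev s ⟨x, Or.inr (Or.inl hs)⟩ ⟨hx s hs, h.trans_lt hr.2⟩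
  · refine Or.inr (Or.inr fun r hr => ⟨?_, hns r hr⟩)
    rintro ⟨x, a, ha, har, hx⟩
    rcases le_or_gt a u with hau | hau
    · exact hw ⟨x, a, ha, hau, fun s hs => hr.1.trans_lt (hx s hs)⟩
    · exact hev a ⟨x, Or.inl ha⟩ ⟨hau, har.trans_lt hr.2⟩

theorem sending_of_mem {x : P} {q : Queue V Q} {s u v : ℝ}
    (h : X.start x q = some s) (hsu : s ≤ u) (hve : v ≤ s + X.size x / N.C) :
    ∀ r ∈ Set.Ico u v, X.Sending q r :=
  fun _ hr => ⟨x, s, h, hsu.trans hr.1, hr.2.trans_le hve⟩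

namespace IsRun

variable (hX : X.IsRun)
include hX

theorem duration_pos (x : P) : 0 < X.size x / N.C := div_pos (hX.size_pos x) N.C_pos

theorem mem_queues_of_start {x : P} {q : Queue V Q} {s : ℝ} (h : X.start x q = some s) :
    q ∈ (S.flow (X.flowOf x)).queues := by
  obtain ⟨a, ha, -⟩ := hX.start_arrived x q s h
  exact ha.1

theorem size_le_L {x : P} {q : Queue V Q} (h : q ∈ (S.flow (X.flowOf x)).queues) :
    X.size x ≤ N.L q :=
  (hX.size_le x).trans ((S.flow (X.flowOf x)).size_le q h)

/-- Induction along the route of a packet. -/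
theorem arrives_induction {x : P} {motive : Queue V Q → ℝ → Prop}
    (emit : ∀ q, (S.flow (X.flowOf x)).before q = [] → motive q (X.emit x))
    (hop : ∀ q q' a s, X.Arrives x q' a → a ≤ s → X.start x q' = some s →
      (S.flow (X.flowOf x)).before q = (S.flow (X.flowOf x)).before q' ++ [q'] →
      motive q' a → motive q (s + X.size x / N.C))
    {q : Queue V Q} {a : ℝ} (h : X.Arrives x q a) : motive q a := by
  obtain ⟨m, hm⟩ : ∃ m, ((S.flow (X.flowOf x)).before q).length = m := ⟨_, rfl⟩
  induction m using Nat.strong_induction_on generalizing q a with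
  | _ m ih =>
    obtain ⟨hq, ⟨hp, rfl⟩ | ⟨q', hp, s, hs, rfl⟩⟩ := h
    · rcases Flow.pred_cases _ hq with ⟨hb, -⟩ | ⟨p, -, -, -, hp'⟩
      · exact emit q hb
      · simp [hp] at hp'
    · obtain ⟨-, -, hb⟩ := Flow.of_pred_eq_some _ hq hp
      obtain ⟨b, hb', hbs⟩ := hX.start_arrived x q' s hs
      exact hop q q' b s hb' hbs hs hb (ih _ (by rw [← hm, hb]; simp) hb' rfl)

theorem emit_add_accMin_le {x : P} {q : Queue V Q} {a : ℝ} (h : X.Arrives x q a) :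
    X.emit x + (S.flow (X.flowOf x)).accMin q ≤ a := by
  refine hX.arrives_induction
    (motive := fun q a => X.emit x + (S.flow (X.flowOf x)).accMin q ≤ a) ?_ ?_ h
  · intro q hb
    simp [Flow.accMin, hb]
  · intro q q' a s _ has _ hb ih
    have := div_le_div_of_nonneg_right (hX.size_ge x) N.C_pos.le
    simp only [Flow.accMin, hb, List.length_append, List.length_singleton] at ih ⊢
    push_cast
    linarith

theorem emit_le_of_arrives {x : P} {q : Queue V Q} {a : ℝ} (h : X.Arrives x q a) :
    X.emit x ≤ a := by
  have h1 := hX.emit_add_accMin_le h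
  have h2 : 0 ≤ (S.flow (X.flowOf x)).accMin q :=
    mul_nonneg (Nat.cast_nonneg _) (div_nonneg (Flow.l_nonneg _) N.C_pos.le)
  linarith

theorem arrives_nonneg {x : P} {q : Queue V Q} {a : ℝ} (h : X.Arrives x q a) : 0 ≤ a :=
  (hX.emit_nonneg x).trans (hX.emit_le_of_arrives h)

theorem emit_le_of_start {x : P} {q : Queue V Q} {s : ℝ} (h : X.start x q = some s) :
    X.emit x ≤ s := by
  obtain ⟨a, ha, has⟩ := hX.start_arrived x q s h
  exact (hX.emit_le_of_arrives ha).trans has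

/-- If the delay budgets were met at the queues that packet `x` reached before time `a`, then the
accumulated budget bounds the time that the packet needed to reach its queue at time `a`. -/
theorem le_emit_add_accMax {x : P} {q : Queue V Q} {a : ℝ} (h : X.Arrives x q a)
    (hD : ∀ q' b, b < a → X.Arrives x q' b → ∃ d, X.Departs x q' d ∧ d ≤ b + N.Dmax q') :
    a ≤ X.emit x + (S.flow (X.flowOf x)).accMax q := by
  refine hX.arrives_induction (motive := fun q a =>
    (∀ q' b, b < a → X.Arrives x q' b → ∃ d, X.Departs x q' d ∧ d ≤ b + N.Dmax q') →
      a ≤ X.emit x + (S.flow (X.flowOf x)).accMax q) ?_ ?_ h hD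
  · intro q hb _
    simp [Flow.accMax, hb]
  · intro q q' a s ha has hs hb ih hD
    have hpos := hX.duration_pos x
    obtain ⟨d, hd, hda⟩ := hD q' a (by linarith) ha
    have := ih (fun p b hba => hD p b (by linarith))
    rw [hd.unique ⟨s, hs, rfl⟩] at hda
    simp only [Flow.accMax, hb, List.map_append, List.sum_append, List.map_singleton,
      List.sum_singleton] at this ⊢
    linarith

/-! ### Emissions and events -/

theorem encard_emit_le (i : Fin n) (s : ℝ) (m : ℕ) :
    {x | X.flowOf x = i ∧ s ≤ X.emit x ∧ X.emit x < s + m * (S.flow i).CMI}.encard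
      ≤ m * (S.flow i).MIF := by
  induction m with
  | zero =>
    have : {x | X.flowOf x = i ∧ s ≤ X.emit x ∧ X.emit x < s + (0 : ℕ) * (S.flow i).CMI} = ∅ := by
      ext x
      simp only [Set.mem_ofPred_eq, Set.mem_empty_iff_false, iff_false]
      rintro ⟨-, h1, h2⟩
      simp only [Nat.cast_zero, zero_mul, add_zero] at h2
      linarith
    rw [this]
    simp
  | succ m ih =>
    refine (Set.encard_le_encard (t := {x | X.flowOf x = i ∧ s ≤ X.emit x ∧
      X.emit x < s + m * (S.flow i).CMI} ∪ {x | X.flowOf x = i ∧ s + m * (S.flow i).CMI ≤ X.emit x ∧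
        X.emit x < s + m * (S.flow i).CMI + (S.flow i).CMI}) ?_).trans
      ((Set.encard_union_le _ _).trans ?_)
    · rintro x ⟨hi, h1, h2⟩
      rcases lt_or_ge (X.emit x) (s + m * (S.flow i).CMI) with h | h
      · exact Or.inl ⟨hi, h1, h⟩
      · refine Or.inr ⟨hi, h, ?_⟩
        push_cast at h2
        linarith
    · push_cast
      rw [add_mul, one_mul]
      exact add_le_add ih (hX.emit_interval i _)

theorem finite_emit_le (T : ℝ) : {x | X.emit x ≤ T}.Finite := by
  have h : ∀ i : Fin n, ∃ m : ℕ, T < m * (S.flow i).CMI := fun i => by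
    obtain ⟨m, hm⟩ := exists_nat_gt (T / (S.flow i).CMI)
    exact ⟨m, (div_lt_iff₀ (S.flow i).CMI_pos).1 hm⟩
  choose m hm using h
  refine (Set.finite_iUnion fun i : Fin n => Set.finite_of_encard_le_coe
    (k := m i * (S.flow i).MIF) (by exact_mod_cast hX.encard_emit_le i 0 (m i))).subset ?_
  intro x hx
  refine Set.mem_iUnion.2 ⟨X.flowOf x, rfl, hX.emit_nonneg x, ?_⟩
  rw [zero_add]
  exact lt_of_le_of_lt hx (hm _)

/-- The traffic that a flow emits in a half-open interval of length `τ` is bounded by its curve. -/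
theorem sum_size_le_curve (i : Fin n) (Y : Finset P) {s τ : ℝ} (hτ : 0 ≤ τ)
    (hY : ∀ x ∈ Y, X.flowOf x = i ∧ s ≤ X.emit x ∧ X.emit x < s + τ) :
    ∑ x ∈ Y, X.size x ≤ (S.flow i).curve τ := by
  have hC := (S.flow i).CMI_pos
  have hceil : τ ≤ ⌈τ / (S.flow i).CMI⌉₊ * (S.flow i).CMI :=
    (div_le_iff₀ hC).1 (Nat.le_ceil _)
  have hcard : Y.card ≤ ⌈τ / (S.flow i).CMI⌉₊ * (S.flow i).MIF := by
    have h := (Set.encard_le_encard (s := (Y : Set P)) (fun x hx => by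
      obtain ⟨h1, h2, h3⟩ := hY x hx
      exact ⟨h1, h2, by linarith⟩)).trans (hX.encard_emit_le i s ⌈τ / (S.flow i).CMI⌉₊)
    rw [Set.encard_coe_eq_coe_finsetCard] at h
    exact_mod_cast h
  have hsum : ∑ x ∈ Y, X.size x ≤ Y.card * (8 * (S.flow i).MFS : ℝ) := by
    rw [← nsmul_eq_mul]
    refine Finset.sum_le_card_nsmul _ _ _ fun x hx => ?_
    have := hX.size_le x
    rwa [(hY x hx).1] at this
  have hcard' : (Y.card : ℝ) ≤ (⌈τ / (S.flow i).CMI⌉₊ : ℝ) * (S.flow i).MIF := by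
    exact_mod_cast hcard
  have hcast : ((⌈τ / (S.flow i).CMI⌉₊ : ℕ) : ℝ) = ((⌈τ / (S.flow i).CMI⌉ : ℤ) : ℝ) :=
    natCast_ceil_eq_intCast_ceil (div_nonneg hτ hC.le)
  rw [Flow.curve, ← hcast]
  calc _ ≤ _ := hsum
    _ ≤ (⌈τ / (S.flow i).CMI⌉₊ : ℝ) * (S.flow i).MIF * (8 * (S.flow i).MFS : ℝ) :=
      mul_le_mul_of_nonneg_right hcard' (by positivity)
    _ = _ := by ring

theorem finite_events (q : Queue V Q) (T : ℝ) : (X.events q ∩ Set.Iic T).Finite := by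
  refine ((hX.finite_emit_le T).biUnion (t := fun x =>
    {e | X.Arrives x q e} ∪ ({e | X.start x q = some e} ∪ {e | X.Departs x q e}))
    fun x _ => ?_).subset ?_
  · refine Set.Finite.union ?_ (Set.Finite.union ?_ ?_) <;>
      refine Set.Subsingleton.finite fun a ha b hb => ?_
    · exact Arrives.unique ha hb
    · exact Option.some.inj (Eq.trans (Eq.symm ha) hb)
    · exact Departs.unique ha hb
  · rintro e ⟨⟨x, h⟩, heT⟩
    refine Set.mem_biUnion (x := x) ?_ h
    refine le_trans ?_ (Set.mem_Iic.1 heT)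
    rcases h with h | h | ⟨s, hs, rfl⟩
    · exact hX.emit_le_of_arrives h
    · exact hX.emit_le_of_start h
    · linarith [hX.emit_le_of_start hs, hX.duration_pos x]

end IsRun
end Trace

/-! ### Idle slopes and credit bounds -/

namespace Network

theorem idSl_le_C {q : Queue V Q} (hq : q ∈ N.E) : N.idSl q ≤ N.C := by
  refine le_trans ?_ (N.idSl_sum_le q.link)
  exact Finset.single_le_sum (f := N.idSl) (s := N.E.filter fun i => i.link = q.link)
    (fun i hi => (N.idSl_pos i (Finset.mem_filter.1 hi).1).le)
    (Finset.mem_filter.2 ⟨hq, rfl⟩)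

theorem sdSl_nonpos {q : Queue V Q} (hq : q ∈ N.E) : N.sdSl q ≤ 0 :=
  sub_nonpos.2 (Network.idSl_le_C hq)

theorem cmin_nonpos {q : Queue V Q} (hq : q ∈ N.E) : N.cmin q ≤ 0 :=
  mul_nonpos_of_nonpos_of_nonneg (Network.sdSl_nonpos hq)
    (div_nonneg (N.L_nonneg q hq) N.C_pos.le)

end Network

namespace Trace

/-! ### The amount of transmitted data -/

/-- The part of packet `x` that has been transmitted by queue `q` until time `t`, in bits. -/
noncomputable def served (X : Trace S P) (q : Queue V Q) (t : ℝ) (x : P) : ℝ :=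
  (X.start x q).elim 0 fun s => max 0 (min (N.C * (t - s)) (X.size x))

/-- The amount of data that queue `q` has transmitted until time `t`. Only the packets of the
finite set `M` are counted, which is meant to contain all packets emitted until `t`. -/
noncomputable def sent (X : Trace S P) (M : Finset P) (q : Queue V Q) (t : ℝ) : ℝ :=
  ∑ x ∈ M, X.served q t x

/-- The credit, corrected by the service received and by the service reserved since time `0`. -/
noncomputable def ledger (X : Trace S P) (M : Finset P) (q : Queue V Q) (t : ℝ) : ℝ :=
  X.credit q t + X.sent M q t - N.idSl q * t

theorem served_mono (q : Queue V Q) (x : P) : Monotone fun t => X.served q t x := by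
  intro u v huv
  rcases h : X.start x q with _ | s
  · simp [served, h]
  · simp only [served, h, Option.elim_some]
    have := N.C_pos.le
    gcongr

theorem sent_mono (M : Finset P) (q : Queue V Q) : Monotone (X.sent M q) :=
  fun _ _ huv => Finset.sum_le_sum fun x _ => served_mono q x huv

theorem served_nonneg (q : Queue V Q) (t : ℝ) (x : P) : 0 ≤ X.served q t x := by
  rcases h : X.start x q with _ | s <;> simp [served, h]

theorem served_eq_zero {q : Queue V Q} {t : ℝ} {x : P} (h : ∀ s, X.start x q = some s → t ≤ s) :
    X.served q t x = 0 := by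
  rcases h' : X.start x q with _ | s
  · simp [served, h']
  · have := mul_nonpos_of_nonneg_of_nonpos N.C_pos.le (sub_nonpos.2 (h s h'))
    simp only [served, h', Option.elim_some]
    exact max_eq_left (min_le_iff.2 (Or.inl this))

theorem served_eq {q : Queue V Q} {s t : ℝ} {x : P} (h : X.start x q = some s) (hst : s ≤ t)
    (ht : t ≤ s + X.size x / N.C) : X.served q t x = N.C * (t - s) := by
  have h1 : N.C * (t - s) ≤ X.size x := by
    rw [← le_div_iff₀' N.C_pos]; linarith
  have h2 : 0 ≤ N.C * (t - s) := mul_nonneg N.C_pos.le (by linarith)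
  simp only [served, h, Option.elim_some]
  rw [min_eq_left h1, max_eq_right h2]

namespace IsRun

variable (hX : X.IsRun)
include hX

theorem served_eq_size {q : Queue V Q} {t d : ℝ} {x : P} (h : X.Departs x q d) (hd : d ≤ t) :
    X.served q t x = X.size x := by
  obtain ⟨s, hs, rfl⟩ := h
  have : X.size x ≤ N.C * (t - s) := by
    rw [← div_le_iff₀' N.C_pos]; linarith
  simp only [served, hs, Option.elim_some]
  rw [min_eq_right this, max_eq_right (hX.size_pos x).le]

theorem served_le_size (q : Queue V Q) (t : ℝ) (x : P) : X.served q t x ≤ X.size x := by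
  rcases h : X.start x q with _ | s
  · simp [served, h, (hX.size_pos x).le]
  · simp [served, h, (hX.size_pos x).le]

theorem served_lt_size {q : Queue V Q} {t : ℝ} {x : P} (h : ∀ d, X.Departs x q d → t < d) :
    X.served q t x < X.size x := by
  rcases hs : X.start x q with _ | s
  · simp [served, hs, hX.size_pos x]
  · have : N.C * (t - s) < X.size x := by
      rw [← lt_div_iff₀' N.C_pos]
      linarith [h _ ⟨s, hs, rfl⟩]
    simp only [served, hs, Option.elim_some]
    exact max_lt (hX.size_pos x) (min_lt_of_left_lt this)

theorem sent_eq_of_sending {M : Finset P} {q : Queue V Q} {x : P} {s u v : ℝ} (hx : x ∈ M)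
    (h : X.start x q = some s) (hsu : s ≤ u) (huv : u ≤ v) (hve : v ≤ s + X.size x / N.C) :
    X.sent M q v = X.sent M q u + N.C * (v - u) := by
  classical
  have hrest : ∀ y ∈ M.erase x, X.served q v y = X.served q u y := by
    intro y hy
    have hne : (x, q) ≠ (y, q) := fun h => (Finset.ne_of_mem_erase hy) (Prod.mk.inj h).1.symm
    rcases ht : X.start y q with _ | t
    · simp [served, ht]
    · rcases hX.exclusive x y q q s t rfl hne h ht with h' | h'
      · rw [served_eq_zero, served_eq_zero] <;> intro t' ht' <;>
          obtain rfl : t = t' := Option.some.inj (ht.symm.trans ht') <;> linarith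
      · rw [hX.served_eq_size ⟨t, ht, rfl⟩ (by linarith),
          hX.served_eq_size ⟨t, ht, rfl⟩ (by linarith)]
  rw [sent, sent, ← Finset.add_sum_erase M _ hx, ← Finset.add_sum_erase M _ hx,
    Finset.sum_congr rfl hrest, served_eq h hsu (huv.trans hve), served_eq h (hsu.trans huv) hve]
  ring

theorem sent_eq_of_not_sending {M : Finset P} {q : Queue V Q} {u v : ℝ} (huv : u < v)
    (h : ∀ r ∈ Set.Ico u v, ¬ X.Sending q r) : X.sent M q v = X.sent M q u := by
  refine Finset.sum_congr rfl fun y _ => ?_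
  rcases hs : X.start y q with _ | s
  · simp [served, hs]
  · rcases le_or_gt v s with hvs | hsv
    · rw [served_eq_zero, served_eq_zero] <;> intro s' hs' <;>
        obtain rfl : s = s' := Option.some.inj (hs.symm.trans hs') <;> linarith
    · have hdone : s + X.size y / N.C ≤ max u s := by
        by_contra! hlt
        exact h (max u s) ⟨le_max_left _ _, max_lt huv hsv⟩ ⟨y, s, hs, le_max_right _ _, hlt⟩
      have : s + X.size y / N.C ≤ u := by
        rcases le_max_iff.1 hdone with h' | h'
        · exact h'
        · linarith [hX.duration_pos y]
      rw [hX.served_eq_size ⟨s, hs, rfl⟩ (this.trans huv.le),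
        hX.served_eq_size ⟨s, hs, rfl⟩ this]

/-! ### Evolution of the credit -/

/-- To show a transitive relation between the points of an interval, it suffices to show it
between the ends of the intervals in which no event of queue `q` occurs. -/
theorem rel_of_steps (q : Queue V Q) {R : ℝ → ℝ → Prop}
    (htrans : ∀ u v w, R u v → R v w → R u w) {s t : ℝ} (hst : s < t)
    (hstep : ∀ u v, s ≤ u → u < v → v ≤ t → (∀ e ∈ X.events q, ¬ (u < e ∧ e < v)) → R u v) :
    R s t :=
  rel_of_forall_eventless htrans hst
    ((hX.finite_events q t).subset fun _ h => ⟨h.1, h.2.2.le⟩) hstep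

/-- The queue receives at most its reserved service: a reset of the credit, and its saturation
at zero, only lose credit. -/
theorem ledger_antitone {M : Finset P} {q : Queue V Q} (hq : q ∈ N.E) {u v : ℝ} (huv : u ≤ v)
    (hM : ∀ x, X.emit x ≤ v → x ∈ M) : X.ledger M q v ≤ X.ledger M q u := by
  rcases huv.eq_or_lt with rfl | huv
  · rfl
  refine hX.rel_of_steps q (R := fun u v => X.ledger M q v ≤ X.ledger M q u)
    (fun _ _ _ h1 h2 => h2.trans h1) huv fun u' v' _ huv' hv' hev => ?_
  unfold ledger
  rcases X.state_of_eventless hev with ⟨x, s, hs, hsu, -, hve⟩ | h | h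
  · have hx : x ∈ M := hM x (by linarith [hX.emit_le_of_start hs])
    have hsend := sending_of_mem hs hsu hve
    rw [hX.sent_eq_of_sending hx hs hsu huv'.le hve]
    have hsd : N.sdSl q = N.idSl q - N.C := rfl
    have : X.credit q v' ≤ X.credit q u' + N.sdSl q * (v' - u') := by
      by_cases he : X.Empty q v'
      · rw [hX.credit_reset q hq u' v' huv' hsend he]
        exact min_le_right _ _
      · rw [hX.credit_sending q hq u' v' huv' hsend he]
    rw [hsd] at this
    linarith
  · rw [hX.sent_eq_of_not_sending huv' fun r hr => (h r hr).2,
      hX.credit_waiting q hq u' v' huv' h]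
    linarith
  · rw [hX.sent_eq_of_not_sending huv' fun r hr => (h r hr).2,
      hX.credit_empty q hq u' v' huv' h]
    linarith [min_le_right 0 (X.credit q u' + N.idSl q * (v' - u'))]

/-- As long as the queue is not empty, it receives all of its reserved service. -/
theorem le_ledger_of_not_empty {M : Finset P} {q : Queue V Q} (hq : q ∈ N.E) {u v : ℝ}
    (huv : u ≤ v) (hM : ∀ x, X.emit x ≤ v → x ∈ M) (hne : ∀ r, u ≤ r → r ≤ v → ¬ X.Empty q r) :
    X.ledger M q u ≤ X.ledger M q v := by
  rcases huv.eq_or_lt with rfl | huv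
  · rfl
  refine hX.rel_of_steps q (R := fun u v => X.ledger M q u ≤ X.ledger M q v)
    (fun _ _ _ h1 h2 => h1.trans h2) huv fun u' v' hu' huv' hv' hev => ?_
  unfold ledger
  rcases X.state_of_eventless hev with ⟨x, s, hs, hsu, -, hve⟩ | h | h
  · have hx : x ∈ M := hM x (by linarith [hX.emit_le_of_start hs])
    rw [hX.sent_eq_of_sending hx hs hsu huv'.le hve,
      hX.credit_sending q hq u' v' huv' (sending_of_mem hs hsu hve) (hne v' (by linarith) hv'),
      show N.sdSl q = N.idSl q - N.C from rfl]
    linarith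
  · rw [hX.sent_eq_of_not_sending huv' fun r hr => (h r hr).2,
      hX.credit_waiting q hq u' v' huv' h]
    linarith
  · exact absurd (h u' ⟨le_rfl, huv'⟩) (hne u' hu' (by linarith))

theorem credit_le_add {q : Queue V Q} (hq : q ∈ N.E) {u v : ℝ} (huv : u ≤ v) :
    X.credit q v ≤ X.credit q u + N.idSl q * (v - u) := by
  have h1 := hX.ledger_antitone (M := (hX.finite_emit_le v).toFinset) hq huv (by simp)
  have h2 := sent_mono (X := X) (hX.finite_emit_le v).toFinset q huv
  unfold ledger at h1
  linarith

theorem credit_nonpos_of_empty {q : Queue V Q} (hq : q ∈ N.E) {t : ℝ} (h : X.Empty q t) :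
    X.credit q t ≤ 0 := by
  rcases le_or_gt t 0 with ht | ht
  · exact (hX.credit_init q hq t ht).le
  refine hX.rel_of_steps q (R := fun _ v => X.Empty q v → X.credit q v ≤ 0)
    (fun _ _ _ _ h => h) ht (fun u v _ huv _ hev he => ?_) h
  rcases X.state_of_eventless hev with ⟨x, s, hs, hsu, -, hve⟩ | h | h
  · rw [hX.credit_reset q hq u v huv (sending_of_mem hs hsu hve) he]
    exact min_le_left _ _
  · -- A packet that waits until `v` would start at `v` and occupy the queue.
    exfalso
    obtain ⟨x, a, ha, hau, hx⟩ := (h u ⟨le_rfl, huv⟩).1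
    have : ¬ ∀ s, X.start x q = some s → v < s := fun hx' => he.1 ⟨x, a, ha, by linarith, hx'⟩
    push Not at this
    obtain ⟨s, hs, hsv⟩ := this
    have hus := hx s hs
    rcases hsv.eq_or_lt with rfl | hsv
    · exact he.2 ⟨x, s, hs, le_rfl, by linarith [hX.duration_pos x]⟩
    · exact (h s ⟨hus.le, hsv⟩).2 ⟨x, s, hs, le_rfl, by linarith [hX.duration_pos x]⟩
  · rw [hX.credit_empty q hq u v huv h]
    exact min_le_left _ _

theorem credit_nonpos_of_not_eligible {q : Queue V Q} (hq : q ∈ N.E) {t : ℝ}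
    (h : ¬ X.Eligible q t) (hs : ¬ X.Sending q t) : X.credit q t ≤ 0 := by
  by_cases hw : X.Waiting q t
  · by_contra! hc
    exact h ⟨hw, hc.le⟩
  · exact hX.credit_nonpos_of_empty hq ⟨hw, hs⟩

/-- Credit is only lost during transmissions, which start with nonnegative credit. -/
theorem cmin_le_credit {q : Queue V Q} (hq : q ∈ N.E) (t : ℝ) : N.cmin q ≤ X.credit q t := by
  have h0 := Network.cmin_nonpos hq
  rcases le_or_gt t 0 with ht | ht
  · rwa [hX.credit_init q hq t ht]
  refine hX.rel_of_steps q (R := fun u v => N.cmin q ≤ X.credit q u → N.cmin q ≤ X.credit q v)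
    (fun _ _ _ h1 h2 h => h2 (h1 h)) ht (fun u v _ huv _ hev hu => ?_)
    (by rwa [hX.credit_init q hq 0 le_rfl])
  have hid := mul_nonneg (N.idSl_pos q hq).le (sub_nonneg.2 huv.le)
  rcases X.state_of_eventless hev with ⟨x, s, hs, hsu, -, hve⟩ | h | h
  · -- The credit is nonnegative when the transmission starts, at time `s`.
    have hsend := sending_of_mem hs le_rfl hve
    have hsv : s < v := by linarith
    have hstart := hX.start_credit x q s hs
    have hdur : v - s ≤ N.L q / N.C := by
      have := div_le_div_of_nonneg_right (hX.size_le_L (hX.mem_queues_of_start hs)) N.C_pos.le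
      linarith
    have hlow : N.cmin q ≤ X.credit q s + N.sdSl q * (v - s) := by
      have := mul_le_mul_of_nonpos_left hdur (Network.sdSl_nonpos hq)
      unfold Network.cmin
      linarith
    by_cases he : X.Empty q v
    · rw [hX.credit_reset q hq s v hsv hsend he]
      exact le_min h0 hlow
    · rw [hX.credit_sending q hq s v hsv hsend he]
      exact hlow
  · rw [hX.credit_waiting q hq u v huv h]
    linarith
  · rw [hX.credit_empty q hq u v huv h]
    exact le_min h0 (by linarith)

/-- Every time `t` is preceded by a time `s` at which all earlier packets have left the queue and
from which on the queue has received all of its reserved service: the last time at which credit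
was lost or, if there is none, time `0`. -/
theorem exists_clear {M : Finset P} {q : Queue V Q} (hq : q ∈ N.E) {t : ℝ} (ht : 0 ≤ t)
    (hM : ∀ x, X.emit x ≤ t → x ∈ M) :
    ∃ s, 0 ≤ s ∧ s ≤ t ∧ (∀ x b, X.Arrives x q b → b < s → ∃ d, X.Departs x q d ∧ d ≤ s) ∧
      X.sent M q s - N.idSl q * s ≤ X.ledger M q t := by
  have hbase : ∀ x b, X.Arrives x q b → b < 0 → ∃ d, X.Departs x q d ∧ d ≤ 0 :=
    fun x b hb hb0 => absurd (hX.arrives_nonneg hb) (not_le.2 hb0)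
  rcases ht.eq_or_lt with rfl | ht
  · exact ⟨0, le_rfl, le_rfl, hbase, by simp [ledger, hX.credit_init q hq 0 le_rfl]⟩
  set J : ℝ → Prop := fun t => ∃ s, 0 ≤ s ∧ s ≤ t ∧
    (∀ x b, X.Arrives x q b → b < s → ∃ d, X.Departs x q d ∧ d ≤ s) ∧
      X.sent M q s - N.idSl q * s ≤ X.ledger M q t with hJ
  refine hX.rel_of_steps q (R := fun u v => J u → J v) (fun _ _ _ h1 h2 h => h2 (h1 h)) ht ?_
    ⟨0, le_rfl, le_rfl, hbase, by simp [ledger, hX.credit_init q hq 0 le_rfl]⟩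
  rintro u v hu huv hv hev ⟨s, hs0, hsu, hclear, hs⟩
  -- If no credit is lost between `u` and `v`, then `s` is kept; otherwise it is moved to `v`.
  have hkeep : X.ledger M q u ≤ X.ledger M q v → J v :=
    fun h => ⟨s, hs0, hsu.trans huv.le, hclear, hs.trans h⟩
  have hmove : X.credit q v = 0 →
      (∀ x b, X.Arrives x q b → b < v → ∃ d, X.Departs x q d ∧ d ≤ v) → J v :=
    fun hc h => ⟨v, hu.trans huv.le, le_rfl, h, by simp [ledger, hc]⟩
  have hdep : ∀ r ≤ v, X.Empty q r → ∀ x b, X.Arrives x q b → b ≤ r →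
      ∃ d, X.Departs x q d ∧ d ≤ v := by
    intro r hr he x b hb hbr
    have : ¬ ∀ s, X.start x q = some s → r < s := fun h => he.1 ⟨x, b, hb, hbr, h⟩
    push Not at this
    obtain ⟨σ, hσ, hσr⟩ := this
    refine ⟨_, ⟨σ, hσ, rfl⟩, ?_⟩
    by_contra! h
    exact he.2 ⟨x, σ, hσ, hσr, by linarith⟩
  rcases X.state_of_eventless hev with ⟨x, σ, hσ, hσu, -, hve⟩ | h | h
  · have hx : x ∈ M := hM x (by linarith [hX.emit_le_of_start hσ])
    have hsend := sending_of_mem hσ hσu hve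
    have hsent := hX.sent_eq_of_sending hx hσ hσu huv.le hve
    have hsd : N.sdSl q = N.idSl q - N.C := rfl
    by_cases he : X.Empty q v
    · have hc := hX.credit_reset q hq u v huv hsend he
      rcases min_choice 0 (X.credit q u + N.sdSl q * (v - u)) with h | h
      · exact hmove (hc.trans h) fun x b hb hbv => hdep v le_rfl he x b hb hbv.le
      · refine hkeep ?_
        unfold ledger
        rw [hc, h, hsent, hsd]
        linarith
    · refine hkeep ?_
      unfold ledger
      rw [hX.credit_sending q hq u v huv hsend he, hsent, hsd]
      linarith
  · refine hkeep ?_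
    unfold ledger
    rw [hX.sent_eq_of_not_sending huv fun r hr => (h r hr).2, hX.credit_waiting q hq u v huv h]
    linarith
  · have hc := hX.credit_empty q hq u v huv h
    rcases min_choice 0 (X.credit q u + N.idSl q * (v - u)) with h' | h'
    · refine hmove (hc.trans h') fun x b hb hbv => ?_
      exact hdep (max u b) (max_le huv.le hbv.le)
        (h _ ⟨le_max_left _ _, max_lt huv hbv⟩) x b hb (le_max_right _ _)
    · refine hkeep ?_
      unfold ledger
      rw [hX.sent_eq_of_not_sending huv fun r hr => (h r hr).2, hc, h']
      linarith

end IsRun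
end Trace

/-! ### The maximum credit -/

namespace Network

theorem mem_higher {q i : Queue V Q} :
    i ∈ N.higher q ↔ i ∈ N.E ∧ i.link = q.link ∧ q.prio < i.prio := by
  simp [higher]

theorem mem_lower {q i : Queue V Q} :
    i ∈ N.lower q ↔ i ∈ N.E ∧ i.link = q.link ∧ i.prio < q.prio := by
  simp [lower]

theorem sum_higher_add_le {q : Queue V Q} (hq : q ∈ N.E) :
    ∑ i ∈ N.higher q, N.idSl i + N.idSl q ≤ N.C := by
  classical
  have hnot : q ∉ N.higher q := fun h => lt_irrefl _ (mem_higher.1 h).2.2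
  rw [add_comm, ← Finset.sum_insert hnot]
  refine (Finset.sum_le_sum_of_subset_of_nonneg ?_ fun i hi _ =>
    (N.idSl_pos i (Finset.mem_filter.1 hi).1).le).trans (N.idSl_sum_le q.link)
  intro i hi
  rcases Finset.mem_insert.1 hi with rfl | hi
  · exact Finset.mem_filter.2 ⟨hq, rfl⟩
  · exact Finset.mem_filter.2 ⟨(mem_higher.1 hi).1, (mem_higher.1 hi).2.1⟩

theorem L_le_Llow {q i : Queue V Q} (hi : i ∈ N.lower q) : N.L i ≤ N.Llow q :=
  (Finset.le_fold_max _).2 (Or.inr ⟨i, hi, le_rfl⟩)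

theorem Lbe_le_Llow (q : Queue V Q) : N.Lbe q.link ≤ N.Llow q :=
  (Finset.le_fold_max _).2 (Or.inl le_rfl)

theorem Llow_nonneg (q : Queue V Q) : 0 ≤ N.Llow q := (N.Lbe_nonneg _).trans (Lbe_le_Llow q)

/-- The rate at which the credit of `q` grows per unit of credit that the higher priorities lose
together. -/
noncomputable def exchangeRate (N : Network V Q) (q : Queue V Q) : ℝ :=
  N.idSl q / (N.C - ∑ i ∈ N.higher q, N.idSl i)

theorem exchangeRate_nonneg {q : Queue V Q} (hq : q ∈ N.E) : 0 ≤ N.exchangeRate q :=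
  div_nonneg (N.idSl_pos q hq).le (by linarith [sum_higher_add_le hq, N.idSl_pos q hq])

theorem exchangeRate_mul {q : Queue V Q} (hq : q ∈ N.E) :
    N.exchangeRate q * (N.C - ∑ i ∈ N.higher q, N.idSl i) = N.idSl q :=
  div_mul_cancel₀ _ (by linarith [sum_higher_add_le hq, N.idSl_pos q hq])

theorem cmax_eq {q : Queue V Q} (hq : q ∈ N.E) :
    N.cmax q = N.exchangeRate q * (N.Llow q - ∑ i ∈ N.higher q, N.cmin i) := by
  have h : N.C - ∑ i ∈ N.higher q, N.idSl i ≠ 0 := by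
    linarith [sum_higher_add_le hq, N.idSl_pos q hq]
  have h' : ∑ i ∈ N.higher q, N.idSl i - N.C ≠ 0 := by
    linarith [sum_higher_add_le hq, N.idSl_pos q hq]
  unfold cmax exchangeRate
  rw [← neg_sub (N.Llow q), ← neg_sub N.C, neg_div_neg_eq]
  ring

theorem cmax_nonneg {q : Queue V Q} (hq : q ∈ N.E) : 0 ≤ N.cmax q := by
  rw [cmax_eq hq]
  have : ∑ i ∈ N.higher q, N.cmin i ≤ 0 :=
    Finset.sum_nonpos fun i hi => cmin_nonpos (mem_higher.1 hi).1
  exact mul_nonneg (exchangeRate_nonneg hq) (by linarith [Llow_nonneg (N := N) q])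

end Network

namespace Trace

/-- The credit of `q` plus the credit of the higher priorities at the same port, the latter
converted at the exchange rate. It does not grow while one of these queues transmits. -/
noncomputable def potential (X : Trace S P) (q : Queue V Q) (t : ℝ) : ℝ :=
  X.credit q t + N.exchangeRate q * ∑ i ∈ N.higher q, X.credit i t

namespace IsRun

variable (hX : X.IsRun)
include hX

theorem potential_le_add {q : Queue V Q} (hq : q ∈ N.E) {u v : ℝ} (huv : u ≤ v) :
    X.potential q v ≤ X.potential q u + N.C * N.exchangeRate q * (v - u) := by
  have h1 := hX.credit_le_add hq huv
  have h2 : ∑ i ∈ N.higher q, X.credit i v ≤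
      ∑ i ∈ N.higher q, X.credit i u + (∑ i ∈ N.higher q, N.idSl i) * (v - u) := by
    rw [Finset.sum_mul, ← Finset.sum_add_distrib]
    exact Finset.sum_le_sum fun i hi => hX.credit_le_add (Network.mem_higher.1 hi).1 huv
  have h3 := mul_le_mul_of_nonneg_left h2 (Network.exchangeRate_nonneg hq)
  have h4 := Network.exchangeRate_mul hq
  unfold potential
  linear_combination h1 + h3 - (v - u) * h4

theorem potential_le_of_credit_nonpos {q : Queue V Q} (hq : q ∈ N.E) {u v : ℝ} (huv : u ≤ v)
    (h : X.credit q u ≤ 0) (h' : ∀ i ∈ N.higher q, X.credit i u ≤ 0) :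
    X.potential q v ≤ N.C * N.exchangeRate q * (v - u) := by
  have h1 := hX.potential_le_add hq huv
  have h2 : X.potential q u ≤ 0 := add_nonpos h
    (mul_nonpos_of_nonneg_of_nonpos (Network.exchangeRate_nonneg hq) (Finset.sum_nonpos h'))
  linarith

/-- While the port serves neither `q` nor a higher priority, the potential is bounded by its
growth during one packet of lower priority: none of these queues is eligible when such a packet
starts, or when the link is idle. -/
theorem potential_le_of_not_sending {q : Queue V Q} (hq : q ∈ N.E) {t : ℝ}
    (h : ¬ X.Sending q t) (h' : ∀ i ∈ N.higher q, ¬ X.Sending i t) :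
    X.potential q t ≤ N.exchangeRate q * N.Llow q := by
  have hC := N.C_pos
  have hK := mul_nonneg (Network.exchangeRate_nonneg hq) (Network.Llow_nonneg (N := N) q)
  -- The bound while a packet of size `z`, started at time `u`, blocks the port.
  have hblock : ∀ u z : ℝ, u ≤ t → t < u + z / N.C → z ≤ N.Llow q →
      (∀ i ∈ N.E, i.link = q.link → q.prio ≤ i.prio → ¬ X.Eligible i u ∧ ¬ X.Sending i u) →
      X.potential q t ≤ N.exchangeRate q * N.Llow q := by
    intro u z hut htz hz hi
    refine (hX.potential_le_of_credit_nonpos hq hut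
      (hX.credit_nonpos_of_not_eligible hq (hi q hq rfl le_rfl).1 (hi q hq rfl le_rfl).2)
      fun i hi' => ?_).trans ?_
    · obtain ⟨hiE, hil, hip⟩ := Network.mem_higher.1 hi'
      exact hX.credit_nonpos_of_not_eligible hiE (hi i hiE hil hip.le).1 (hi i hiE hil hip.le).2
    · have : N.C * (t - u) ≤ N.Llow q := by
        rw [← le_div_iff₀' hC]
        have := div_le_div_of_nonneg_right hz hC.le
        linarith
      have := mul_le_mul_of_nonneg_left this (Network.exchangeRate_nonneg hq)
      linarith
  by_cases hbusy : X.Busy q.link t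
  · rcases hbusy with ⟨j, hj, hjl, y, s, hs, hst, hts⟩ | ⟨b, hb, hbt, htb⟩
    · have hlow : j.prio < q.prio := by
        by_contra! hle
        rcases hle.eq_or_lt with heq | hlt
        · obtain rfl : j = q := by
            cases j; cases q
            simp only [Queue.link, Prod.mk.injEq] at hjl heq
            simp [hjl, heq]
          exact h ⟨y, s, hs, hst, hts⟩
        · exact h' j (Network.mem_higher.2 ⟨hj, hjl, hlt⟩) ⟨y, s, hs, hst, hts⟩
      refine hblock s (X.size y) hst hts ((hX.size_le_L (hX.mem_queues_of_start hs)).trans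
        (Network.L_le_Llow (Network.mem_lower.2 ⟨hj, hjl, hlow⟩))) fun i hi hil hip => ⟨?_, ?_⟩
      · exact hX.start_priority y j s hs i
          (Network.mem_higher.2 ⟨hi, hil.trans hjl.symm, hlow.trans_le hip⟩)
      · rintro ⟨z, σ, hσ, hσs, hsσ⟩
        have hne : (y, j) ≠ (z, i) := by
          rintro ⟨⟩
          exact absurd hlow (not_lt.2 hip)
        rcases hX.exclusive y z j i s σ (hjl.trans hil.symm) hne hs hσ with h | h
        · linarith [hX.duration_pos y]
        · linarith
    · have hsize := hX.be_size _ b hb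
      refine hblock b.1 b.2 hbt htb (hsize.2.trans (Network.Lbe_le_Llow q))
        fun i hi hil _ => ⟨hX.be_priority _ b hb i hi hil, ?_⟩
      rintro ⟨z, σ, hσ, hσs, hsσ⟩
      have := div_pos hsize.1 hC
      rcases hX.exclusive_be z i σ b (hil ▸ hb) hσ with h | h <;> linarith
  · refine le_trans ?_ hK
    have hne : ∀ i ∈ N.E, i.link = q.link → ¬ X.Eligible i t := fun i hi hil he =>
      hbusy (hil ▸ hX.work_conserving i hi t he)
    have := hX.potential_le_of_credit_nonpos hq (le_refl t)
      (hX.credit_nonpos_of_not_eligible hq (hne q hq rfl) h) fun i hi =>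
        hX.credit_nonpos_of_not_eligible (Network.mem_higher.1 hi).1
          (hne i (Network.mem_higher.1 hi).1 (Network.mem_higher.1 hi).2.1) (h' i hi)
    linarith

theorem credit_le_add_of_sending {q : Queue V Q} (hq : q ∈ N.E) {u v : ℝ} (huv : u < v)
    (h : ∀ r ∈ Set.Ico u v, X.Sending q r) :
    X.credit q v ≤ X.credit q u + N.sdSl q * (v - u) := by
  by_cases he : X.Empty q v
  · rw [hX.credit_reset q hq u v huv h he]
    exact min_le_right _ _
  · rw [hX.credit_sending q hq u v huv h he]

/-- While `q` or a higher priority transmits, the exchange rate makes the losses of credit outweigh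
the gains. -/
theorem potential_le_of_sending {q j : Queue V Q} (hq : q ∈ N.E)
    (hj : j = q ∨ j ∈ N.higher q) {u v : ℝ} (huv : u < v)
    (h : ∀ r ∈ Set.Ico u v, X.Sending j r) : X.potential q v ≤ X.potential q u := by
  classical
  have hx := Network.exchangeRate_nonneg hq
  have hmul := Network.exchangeRate_mul hq
  have hvu : 0 ≤ v - u := by linarith
  unfold potential
  rcases hj with rfl | hj
  · have h1 := hX.credit_le_add_of_sending hq huv h
    have h2 : ∑ i ∈ N.higher j, X.credit i v ≤
        ∑ i ∈ N.higher j, X.credit i u + (∑ i ∈ N.higher j, N.idSl i) * (v - u) := by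
      rw [Finset.sum_mul, ← Finset.sum_add_distrib]
      exact Finset.sum_le_sum fun i hi =>
        hX.credit_le_add (Network.mem_higher.1 hi).1 huv.le
    have h3 := mul_le_mul_of_nonneg_left h2 hx
    -- The idle slopes of the port sum to at most `C`, so that the exchange rate is at most one.
    have h4 : N.exchangeRate j ≤ 1 := by
      refine div_le_one_of_le₀ ?_ ?_ <;>
        linarith [Network.sum_higher_add_le hq, N.idSl_pos j hq]
    have h5 := mul_le_mul_of_nonneg_right h4 (mul_nonneg N.C_pos.le hvu)
    rw [show N.sdSl j = N.idSl j - N.C from rfl] at h1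
    linear_combination h1 + h3 - (v - u) * hmul + h5
  · have h1 := hX.credit_le_add hq huv.le
    have h2 : ∑ i ∈ N.higher q, X.credit i v ≤ ∑ i ∈ N.higher q,
        (X.credit i u + (N.idSl i - if i = j then N.C else 0) * (v - u)) := by
      refine Finset.sum_le_sum fun i hi => ?_
      split_ifs with hij
      · subst hij
        exact hX.credit_le_add_of_sending (Network.mem_higher.1 hi).1 huv h
      · rw [sub_zero]
        exact hX.credit_le_add (Network.mem_higher.1 hi).1 huv.le
    rw [Finset.sum_add_distrib, ← Finset.sum_mul, Finset.sum_sub_distrib, Finset.sum_ite_eq',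
      if_pos hj] at h2
    have h3 := mul_le_mul_of_nonneg_left h2 hx
    linear_combination h1 + h3 - (v - u) * hmul

theorem potential_le {q : Queue V Q} (hq : q ∈ N.E) (t : ℝ) :
    X.potential q t ≤ N.exchangeRate q * N.Llow q := by
  classical
  have hK := mul_nonneg (Network.exchangeRate_nonneg hq) (Network.Llow_nonneg (N := N) q)
  have hinit : ∀ t ≤ 0, X.potential q t ≤ N.exchangeRate q * N.Llow q := fun t ht => by
    have := hX.potential_le_of_credit_nonpos hq (le_refl t) (hX.credit_init q hq t ht).le
      fun i hi => (hX.credit_init i (Network.mem_higher.1 hi).1 t ht).le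
    linarith
  rcases le_or_gt t 0 with ht | ht
  · exact hinit t ht
  refine rel_of_forall_eventless (Ev := ⋃ i ∈ insert q (N.higher q), X.events i)
    (R := fun u v => X.potential q u ≤ N.exchangeRate q * N.Llow q →
      X.potential q v ≤ N.exchangeRate q * N.Llow q)
    (fun _ _ _ h1 h2 h => h2 (h1 h)) ht ?_ (fun u v _ huv _ hev hu => ?_) (hinit 0 le_rfl)
  · have : (⋃ i ∈ insert q (N.higher q), X.events i ∩ Set.Iic t).Finite :=
      (insert q (N.higher q)).finite_toSet.biUnion fun i _ => hX.finite_events i t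
    refine this.subset ?_
    rintro e ⟨he, he'⟩
    simp only [Set.mem_iUnion] at he ⊢
    obtain ⟨i, hi, he⟩ := he
    exact ⟨i, hi, he, he'.2.le⟩
  have hev' : ∀ i ∈ insert q (N.higher q), ∀ e ∈ X.events i, ¬ (u < e ∧ e < v) :=
    fun i hi e he => hev e (Set.mem_biUnion hi he)
  by_cases hsend : ∃ j ∈ insert q (N.higher q), X.Sending j u
  · obtain ⟨j, hj, hju⟩ := hsend
    refine (hX.potential_le_of_sending (j := j) hq (Finset.mem_insert.1 hj) huv ?_).trans hu
    rcases X.state_of_eventless (hev' j hj) with ⟨x, s, hs, hsu, -, hve⟩ | h | h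
    · exact sending_of_mem hs hsu hve
    · exact absurd hju (h u ⟨le_rfl, huv⟩).2
    · exact absurd hju (h u ⟨le_rfl, huv⟩).2
  · push Not at hsend
    have hr : ∀ r ∈ Set.Ico u v, X.potential q r ≤ N.exchangeRate q * N.Llow q := fun r hr =>
      hX.potential_le_of_not_sending hq
        (not_sending_of_eventless (hev' q (Finset.mem_insert_self _ _))
          (hsend q (Finset.mem_insert_self _ _)) r hr)
        fun i hi => not_sending_of_eventless (hev' i (Finset.mem_insert_of_mem hi))
          (hsend i (Finset.mem_insert_of_mem hi)) r hr
    -- The bound holds before `v` and extends to `v`, as the potential grows at a bounded rate.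
    have hB : 0 ≤ N.C * N.exchangeRate q :=
      mul_nonneg N.C_pos.le (Network.exchangeRate_nonneg hq)
    refine le_of_forall_pos_le_add fun ε hε => ?_
    set B := N.C * N.exchangeRate q
    have hδ : 0 < ε / (B + 1) := by positivity
    set r := max u (v - ε / (B + 1)) with hrdef
    have hrv : r < v := max_lt huv (by linarith)
    have h1 := hr r ⟨le_max_left _ _, hrv⟩
    have h2 := hX.potential_le_add hq hrv.le
    have h3 : B * (v - r) ≤ ε := by
      have h4 : v - r ≤ ε / (B + 1) := by linarith [le_max_right u (v - ε / (B + 1))]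
      calc B * (v - r) ≤ (B + 1) * (v - r) := by
            apply mul_le_mul_of_nonneg_right <;> linarith
        _ ≤ (B + 1) * (ε / (B + 1)) := by gcongr
        _ = ε := by field_simp
    linarith

theorem credit_le_cmax {q : Queue V Q} (hq : q ∈ N.E) (t : ℝ) : X.credit q t ≤ N.cmax q := by
  have h1 := hX.potential_le hq t
  have h2 : ∑ i ∈ N.higher q, N.cmin i ≤ ∑ i ∈ N.higher q, X.credit i t :=
    Finset.sum_le_sum fun i hi => hX.cmin_le_credit (Network.mem_higher.1 hi).1 t
  have h3 := mul_le_mul_of_nonneg_left h2 (Network.exchangeRate_nonneg hq)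
  rw [Network.cmax_eq hq]
  unfold potential at h1
  linarith

/-! ### Service curve and shaping -/

/-- The queue offers its CBS service curve: if the traffic that arrives during any time interval
`[s, a]` is served by the curve within `a - s + H`, then a packet that arrives at time `a` departs
by time `a + H`. -/
theorem exists_departs_le {q : Queue V Q} (hq : q ∈ N.E) {x : P} {a H : ℝ}
    (ha : X.Arrives x q a) (hH : 0 ≤ H)
    (hbound : ∀ s, 0 ≤ s → s ≤ a → ∀ Y : Finset P,
      (∀ y ∈ Y, ∃ b, X.Arrives y q b ∧ s ≤ b ∧ b ≤ a) →
        ∑ y ∈ Y, X.size y ≤ N.serviceCurve q (a - s + H)) :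
    ∃ d, X.Departs x q d ∧ d ≤ a + H := by
  classical
  by_contra! hno
  have hne : ∀ r, a ≤ r → r ≤ a + H → ¬ X.Empty q r := by
    rintro r har hrT ⟨hw, hs⟩
    refine hw ⟨x, a, ha, har, fun σ hσ => ?_⟩
    by_contra! hσr
    have := hno _ ⟨σ, hσ, rfl⟩
    exact hs ⟨x, σ, hσ, hσr, by linarith⟩
  set M := (hX.finite_emit_le (a + H)).toFinset with hMdef
  have hM : ∀ y, X.emit y ≤ a + H → y ∈ M := fun y hy => by simpa [hMdef] using hy
  obtain ⟨s, hs0, hsa, hclear, hs⟩ := hX.exists_clear hq (hX.arrives_nonneg ha) (M := M)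
    fun y hy => hM y (by linarith)
  set Y := M.filter fun y => ∃ b, X.Arrives y q b ∧ s ≤ b ∧ b ≤ a with hY
  have hservice : N.idSl q * (a + H - s) - N.cmax q ≤ X.sent M q (a + H) - X.sent M q s := by
    have h1 := hX.le_ledger_of_not_empty hq (by linarith) hM hne
    have h2 := hX.credit_le_cmax hq (a + H)
    have h3 := hs.trans h1
    rw [ledger] at h3
    linarith
  have hβ : N.serviceCurve q (a - s + H) ≤ X.sent M q (a + H) - X.sent M q s := by
    have hid := N.idSl_pos q hq
    have hmono := sent_mono (X := X) M q (show s ≤ a + H by linarith)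
    unfold Network.serviceCurve rateLatency
    rw [mul_max_of_nonneg _ _ hid.le, mul_sub, mul_div_cancel₀ _ hid.ne', mul_zero]
    refine max_le ?_ (by linarith)
    linarith
  have hlt : X.sent M q (a + H) - X.sent M q s < ∑ y ∈ Y, X.size y := by
    have hzero : ∀ y ∈ M, y ∉ Y → X.served q (a + H) y - X.served q s y = 0 := by
      intro y hyM hyY
      rcases hst : X.start y q with _ | σ
      · simp [served, hst]
      obtain ⟨b, hb, hbσ⟩ := hX.start_arrived y q σ hst
      rcases lt_or_ge b s with hbs | hsb
      · obtain ⟨d, hd, hds⟩ := hclear y b hb hbs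
        rw [hX.served_eq_size hd hds, hX.served_eq_size hd (by linarith), sub_self]
      -- A later arrival is served only after the departure of `x`.
      have hab : a < b := by
        by_contra! hba
        exact hyY (Finset.mem_filter.2 ⟨hyM, b, hb, hsb, hba⟩)
      obtain ⟨τ, hτ, hτσ⟩ := hX.fifo x y q a b σ ha hb hab hst
      have hxy : (x, q) ≠ (y, q) := by
        rintro ⟨⟩
        exact hab.ne (ha.unique hb)
      have hτd : τ + X.size x / N.C ≤ σ := by
        rcases hX.exclusive x y q q τ σ rfl hxy hτ hst with h | h
        · exact h
        · linarith [hX.duration_pos y]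
      have := hno _ ⟨τ, hτ, rfl⟩
      rw [served_eq_zero, served_eq_zero, sub_zero] <;> intro σ' hσ' <;>
        obtain rfl : σ = σ' := Option.some.inj (hst.symm.trans hσ') <;> linarith
    have hxY : x ∈ Y := Finset.mem_filter.2
      ⟨hM x (by linarith [hX.emit_le_of_arrives ha]), a, ha, hsa, le_rfl⟩
    rw [sent, sent, ← Finset.sum_sub_distrib,
      ← Finset.sum_subset (Finset.filter_subset _ M) hzero]
    refine Finset.sum_lt_sum (fun y _ => ?_) ⟨x, hxY, ?_⟩
    · linarith [hX.served_le_size q (a + H) y, served_nonneg (X := X) q s y]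
    · linarith [hX.served_lt_size hno, served_nonneg (X := X) q s x]
  have := hbound s hs0 hsa Y fun y hy => (Finset.mem_filter.1 hy).2
  linarith

/-- The output of a queue conforms to its CBS shaping curve. -/
theorem sum_size_le_cbsShaping {q : Queue V Q} (hq : q ∈ N.E) (Y : Finset P) {s a : ℝ}
    (hsa : s ≤ a) (hY : ∀ y ∈ Y, ∃ d, X.Departs y q d ∧ s ≤ d ∧ d ≤ a) :
    ∑ y ∈ Y, X.size y ≤ N.cbsShaping q (a - s) := by
  classical
  have hid := N.idSl_pos q hq
  have hσ : N.cbsShaping q (a - s) =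
      N.idSl q * (a - s) + N.cmax q - N.cmin q + N.L q := by
    unfold Network.cbsShaping
    field_simp
    ring
  rw [hσ]
  have hprod := mul_nonneg hid.le (sub_nonneg.2 hsa)
  rcases Y.eq_empty_or_nonempty with rfl | hne
  · rw [Finset.sum_empty]
    linarith [Network.cmax_nonneg hq, Network.cmin_nonpos hq, N.L_nonneg q hq]
  choose! d hd hsd hda using hY
  obtain ⟨x, hx, hmin⟩ := Y.exists_min_image d hne
  set M := (hX.finite_emit_le a).toFinset with hMdef
  have hM : ∀ y, X.emit y ≤ a → y ∈ M := fun y hy => by simpa [hMdef] using hy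
  have hYM : Y ⊆ M := fun y hy => by
    obtain ⟨σ, hσ, hσd⟩ := hd y hy
    exact hM y (by linarith [hX.emit_le_of_start hσ, hX.duration_pos y, hda y hy])
  obtain ⟨σx, hσx, hdx⟩ := hd x hx
  -- All packets but the first one are transmitted between the first departure and `a`.
  have hrest : ∑ y ∈ Y.erase x, X.size y ≤ X.sent M q a - X.sent M q (d x) := by
    rw [sent, sent, ← Finset.sum_sub_distrib]
    refine le_trans (Finset.sum_le_sum fun y hy => ?_)
      (Finset.sum_le_sum_of_subset_of_nonneg ((Finset.erase_subset _ _).trans hYM)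
        fun y _ _ => sub_nonneg.2 (served_mono q y (hda x hx)))
    have hyY := Finset.mem_of_mem_erase hy
    obtain ⟨σ, hσ, hdy⟩ := hd y hyY
    have hle : d x ≤ σ := by
      have hxy : (x, q) ≠ (y, q) := fun h => Finset.ne_of_mem_erase hy (Prod.mk.inj h).1.symm
      rcases hX.exclusive x y q q σx σ rfl hxy hσx hσ with h | h
      · rwa [hdx]
      · linarith [hmin y hyY, hX.duration_pos x]
    rw [hX.served_eq_size (hd y hyY) (hda y hyY), served_eq_zero, sub_zero]
    intro σ' hσ'
    obtain rfl : σ = σ' := Option.some.inj (hσ.symm.trans hσ')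
    exact hle
  have h1 := hX.ledger_antitone hq (hda x hx) hM
  have h2 := hX.credit_le_cmax hq (d x)
  have h3 := hX.cmin_le_credit hq a
  have h4 := hX.size_le_L (hX.mem_queues_of_start hσx)
  have h5 := mul_le_mul_of_nonneg_left (hsd x hx) hid.le
  rw [← Finset.add_sum_erase Y _ hx]
  unfold ledger at h1
  linarith

/-- The traffic that a link delivers to a queue conforms to the link shaping curve. -/
theorem sum_size_le_linkShaping {q : Queue V Q} (hq : q ∈ N.E) {l : V × V} (Y : Finset P)
    {s a : ℝ} (hsa : s ≤ a)
    (hY : ∀ y ∈ Y, q ∈ (S.flow (X.flowOf y)).queues ∧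
      ∃ p d, p.link = l ∧ X.Departs y p d ∧ s ≤ d ∧ d ≤ a) :
    ∑ y ∈ Y, X.size y ≤ N.linkShaping q (a - s) := by
  rcases Y.eq_empty_or_nonempty with rfl | ⟨y₀, hy₀⟩
  · rw [Finset.sum_empty]
    exact add_nonneg (N.L_nonneg q hq) (mul_nonneg N.C_pos.le (sub_nonneg.2 hsa))
  have : Nonempty (Queue V Q) := ⟨q⟩
  choose! hqY p d hpl hd hsd hda using hY
  choose! σ hσ hdσ using hd
  have h := sum_length_le_of_disjoint Y σ (fun y => X.size y / N.C) (s := s) (W := N.L q / N.C)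
    (div_nonneg (N.L_nonneg q hq) N.C_pos.le)
    (fun y hy => ⟨hX.duration_pos y,
      div_le_div_of_nonneg_right (hX.size_le_L (hqY y hy)) N.C_pos.le⟩)
    (fun y hy z hz hyz => hX.exclusive y z (p y) (p z) (σ y) (σ z)
      ((hpl y hy).trans (hpl z hz).symm) (fun h => hyz (Prod.mk.inj h).1) (hσ y hy) (hσ z hz))
    hsa (fun y hy => by rw [← hdσ y hy]; exact ⟨hsd y hy, hda y hy⟩)
  rw [← Finset.sum_div, div_le_iff₀ N.C_pos, add_mul, div_mul_cancel₀ _ N.C_pos.ne'] at h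
  unfold Network.linkShaping
  linarith

end IsRun
end Trace

/-! ### Horizontal distance -/

/-- A bound `c` that holds just after time `t` is reached by `g` within the horizontal distance. The
infimum in the definition need not be attained, and `c` may be the right limit of `f` at `t`;
continuity of `g` absorbs both. -/
theorem le_of_horizontalDistance_le {f g : ℝ → ℝ} (hg : Continuous g) (hmono : Monotone g)
    {H t c : ℝ} (hH : 0 ≤ H) (h : horizontalDistance f g ≤ ENNReal.ofReal H) (ht : 0 ≤ t)
    (hc : ∀ ε > 0, c ≤ f (t + ε)) : c ≤ g (t + H) := by
  have key : ∀ ε > 0, c ≤ g (t + H + 2 * ε) := by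
    intro ε hε
    have h1 : (⨅ (d : ℝ) (_ : 0 ≤ d ∧ f (t + ε) ≤ g (t + ε + d)), ENNReal.ofReal d)
        < ENNReal.ofReal (H + ε) :=
      ((le_iSup₂ (f := fun (t : ℝ) (_ : 0 ≤ t) =>
        ⨅ (d : ℝ) (_ : 0 ≤ d ∧ f t ≤ g (t + d)), ENNReal.ofReal d) (t + ε) (by positivity)).trans
          h).trans_lt ((ENNReal.ofReal_lt_ofReal_iff (by positivity)).2 (by linarith))
    obtain ⟨d, hd⟩ := iInf_lt_iff.1 h1
    obtain ⟨⟨-, hfd⟩, hlt⟩ := iInf_lt_iff.1 hd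
    have hdH := (ENNReal.ofReal_lt_ofReal_iff (by positivity)).1 hlt
    exact (hc ε hε).trans (hfd.trans (hmono (by linarith)))
  have hlim : Filter.Tendsto (fun ε : ℝ => g (t + H + 2 * ε)) (nhdsWithin 0 (Set.Ioi 0))
      (nhds (g (t + H))) := by
    have : Continuous fun ε : ℝ => g (t + H + 2 * ε) := by fun_prop
    simpa using (this.tendsto 0).mono_left nhdsWithin_le_nhds
  exact ge_of_tendsto hlim (Filter.eventually_of_mem self_mem_nhdsWithin key)


namespace Network

theorem continuous_serviceCurve (q : Queue V Q) : Continuous (N.serviceCurve q) := by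
  unfold serviceCurve rateLatency
  fun_prop

theorem monotone_serviceCurve {q : Queue V Q} (hq : q ∈ N.E) :
    Monotone (N.serviceCurve q) := by
  intro u v huv
  have := (N.idSl_pos q hq).le
  unfold serviceCurve rateLatency
  gcongr

theorem serviceCurve_le {q : Queue V Q} (hq : q ∈ N.E) {t : ℝ} (ht : 0 ≤ t) :
    N.serviceCurve q t ≤ N.C * t := by
  have h1 : max (t - N.cmax q / N.idSl q) 0 ≤ t :=
    max_le (by linarith [div_nonneg (cmax_nonneg hq) (N.idSl_pos q hq).le]) ht
  exact mul_le_mul (idSl_le_C hq) h1 (le_max_right _ _) N.C_pos.le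

theorem L_le_linkShaping (q : Queue V Q) {t : ℝ} (ht : 0 ≤ t) : N.L q ≤ N.linkShaping q t :=
  le_add_of_nonneg_right (mul_nonneg N.C_pos.le ht)

theorem L_le_cbsShaping {q : Queue V Q} (hq : q ∈ N.E) {t : ℝ} (ht : 0 ≤ t) :
    N.L q ≤ N.cbsShaping q t := by
  have hid := (N.idSl_pos q hq).le
  have : 0 ≤ (N.cmax q - N.cmin q) / N.idSl q :=
    div_nonneg (by linarith [cmax_nonneg hq, cmin_nonpos hq]) hid
  exact le_add_of_nonneg_left (mul_nonneg hid (by linarith))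

theorem cbsShaping_mono {q : Queue V Q} (hq : q ∈ N.E) : Monotone (N.cbsShaping q) := by
  intro u v huv
  have := (N.idSl_pos q hq).le
  unfold cbsShaping
  gcongr

theorem linkShaping_mono (q : Queue V Q) : Monotone (N.linkShaping q) := by
  intro u v huv
  have := N.C_pos.le
  unfold linkShaping
  gcongr

theorem mem_linkQueues {q : Queue V Q} {l : V × V} :
    q ∈ N.linkQueues l ↔ q ∈ N.E ∧ q.link = l := by
  simp [linkQueues]

end Network

/-! ### Flow curves and queue arrival curves -/

namespace Flow

theorem curve_nonneg (f : Flow N) {t : ℝ} (h : 0 ≤ t ∨ f.MIF = 0) : 0 ≤ f.curve t := by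
  rcases h with h | h
  · have : (0 : ℤ) ≤ ⌈t / f.CMI⌉ := Int.ceil_nonneg (div_nonneg h f.CMI_pos.le)
    have : (0 : ℝ) ≤ (⌈t / f.CMI⌉ : ℝ) := by exact_mod_cast this
    unfold curve
    positivity
  · simp [curve, h]

theorem le_curve (f : Flow N) {t : ℝ} (ht : 0 < t) (h : f.MIF ≠ 0) :
    (8 * f.MFS : ℝ) ≤ f.curve t := by
  have h1 : (1 : ℤ) ≤ ⌈t / f.CMI⌉ := Int.one_le_ceil_iff.2 (div_pos ht f.CMI_pos)
  have h1 : (1 : ℝ) ≤ (⌈t / f.CMI⌉ : ℝ) := by exact_mod_cast h1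
  have h2 : (1 : ℝ) ≤ f.MIF := by exact_mod_cast Nat.one_le_iff_ne_zero.2 h
  have h3 := one_le_mul_of_one_le_of_one_le h2 h1
  calc (8 * f.MFS : ℝ) = 8 * f.MFS * 1 := by ring
    _ ≤ 8 * f.MFS * (f.MIF * (⌈t / f.CMI⌉ : ℝ)) := by gcongr
    _ = f.curve t := by unfold curve; ring

theorem deltaD_of_before {f : Flow N} {q q' : Queue V Q} (h : f.before q = f.before q' ++ [q']) :
    f.deltaD q = f.deltaD q' + (N.Dmax q' - f.l / N.C) := by
  simp only [deltaD, accMax, accMin, h, List.map_append, List.sum_append, List.map_singleton,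
    List.sum_singleton, List.length_append, List.length_singleton]
  push_cast
  ring

theorem mem_inLinks {f : Flow N} {q q' : Queue V Q} (hq : q ∈ f.queues)
    (h : f.pred q = some q') : q'.link ∈ N.inLinks q.src := by
  obtain ⟨hq', hd, -⟩ := f.of_pred_eq_some hq h
  exact Finset.mem_filter.2 ⟨Finset.mem_image_of_mem _ (f.queues_sub hq'), hd⟩

end Flow

namespace Reservations

theorem mem_localFlows {F : Finset (Fin n)} {q : Queue V Q} {i : Fin n} :
    i ∈ S.localFlows F q ↔ i ∈ F ∧ q ∈ (S.flow i).queues ∧ (S.flow i).pred q = none := by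
  simp [localFlows]

theorem mem_flowsFrom {F : Finset (Fin n)} {q q' : Queue V Q} {i : Fin n} :
    i ∈ S.flowsFrom F q q' ↔ i ∈ F ∧ q ∈ (S.flow i).queues ∧ (S.flow i).pred q = some q' := by
  simp [flowsFrom]

theorem mem_flowsFromLink {F : Finset (Fin n)} {q : Queue V Q} {l : V × V} {i : Fin n} :
    i ∈ S.flowsFromLink F q l ↔
      i ∈ F ∧ q ∈ (S.flow i).queues ∧ ((S.flow i).pred q).map Queue.link = some l := by
  simp only [flowsFromLink, Finset.mem_filter]

/-- The curves at `q` depend only on the flows that traverse `q`. -/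
theorem arrivalCurve_congr {F G : Finset (Fin n)} {q : Queue V Q}
    (h : ∀ i, q ∈ (S.flow i).queues → (i ∈ F ↔ i ∈ G)) :
    S.arrivalCurve F q = S.arrivalCurve G q ∧
      S.improvedArrivalCurve F q = S.improvedArrivalCurve G q := by
  have h1 : S.localFlows F q = S.localFlows G q := by
    ext i
    simp only [mem_localFlows]
    grind
  have h2 : ∀ q', S.flowsFrom F q q' = S.flowsFrom G q q' := by
    intro q'
    ext i
    simp only [mem_flowsFrom]
    grind
  have h3 : ∀ l, S.flowsFromLink F q l = S.flowsFromLink G q l := by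
    intro l
    ext i
    simp only [mem_flowsFromLink]
    grind
  constructor <;> funext t
  · simp only [arrivalCurve, localCurve, h1, h3]
  · simp only [improvedArrivalCurve, localCurve, h1, h2]

theorem improvedArrivalCurve_le_arrivalCurve (F : Finset (Fin n)) (q : Queue V Q) (t : ℝ) :
    S.improvedArrivalCurve F q t ≤ S.arrivalCurve F q t := by
  refine add_le_add le_rfl (Finset.sum_le_sum fun l _ => min_le_min ?_ le_rfl)
  have hmaps : ∀ i ∈ S.flowsFromLink F q l,
      (S.flow i).pred q ∈ (N.linkQueues l).map Function.Embedding.some := by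
    intro i hi
    obtain ⟨-, hq, hl⟩ := mem_flowsFromLink.1 hi
    obtain ⟨q', hq', rfl⟩ := Option.map_eq_some_iff.1 hl
    have := (S.flow i).of_pred_eq_some hq hq'
    exact Finset.mem_map.2
      ⟨q', Network.mem_linkQueues.2 ⟨(S.flow i).queues_sub this.1, rfl⟩, hq'.symm⟩
  rw [← Finset.sum_fiberwise_of_maps_to hmaps, Finset.sum_map]
  refine Finset.sum_le_sum fun q' hq' =>
    (min_le_left _ _).trans_eq (Finset.sum_congr ?_ fun _ _ => rfl)
  ext i
  simp only [mem_flowsFrom, mem_flowsFromLink, Finset.mem_filter, Function.Embedding.some_apply]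
  have := (Network.mem_linkQueues.1 hq').2
  constructor
  · rintro ⟨h1, h2, h3⟩
    exact ⟨⟨h1, h2, by simp [h3, this]⟩, h3⟩
  · rintro ⟨⟨h1, h2, -⟩, h3⟩
    exact ⟨h1, h2, h3⟩

/-- The arrival curve accounts for a whole packet of each flow right away. -/
theorem l_le_improvedArrivalCurve {F : Finset (Fin n)} {q : Queue V Q} {k : Fin n} (hk : k ∈ F)
    (hq : q ∈ (S.flow k).queues) (hMIF : (S.flow k).MIF ≠ 0)
    (hΔ : ∀ i ∈ F, q ∈ (S.flow i).queues → 0 ≤ (S.flow i).deltaD q ∨ (S.flow i).MIF = 0)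
    {t : ℝ} (ht : 0 < t) : (S.flow k).l ≤ S.improvedArrivalCurve F q t := by
  have hcurve : ∀ i ∈ F, q ∈ (S.flow i).queues →
      0 ≤ (S.flow i).curve (t + (S.flow i).deltaD q) := fun i hi hiq =>
    (S.flow i).curve_nonneg ((hΔ i hi hiq).imp_left fun h => add_nonneg ht.le h)
  have hkl : (S.flow k).l ≤ (S.flow k).curve (t + (S.flow k).deltaD q) := by
    have hΔk := (hΔ k hk hq).resolve_right hMIF
    exact (S.flow k).l_le.trans ((S.flow k).le_curve (by linarith) hMIF)
  have hlocal : 0 ≤ S.localCurve F q t := Finset.sum_nonneg fun i hi =>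
    hcurve i (mem_localFlows.1 hi).1 (mem_localFlows.1 hi).2.1
  have hfrom : ∀ l, ∀ q' ∈ N.linkQueues l,
      0 ≤ min (∑ i ∈ S.flowsFrom F q q', (S.flow i).curve (t + (S.flow i).deltaD q))
        (N.cbsShaping q' t) := fun l q' hq' => by
    have hE := (Network.mem_linkQueues.1 hq').1
    exact le_min (Finset.sum_nonneg fun i hi =>
      hcurve i (mem_flowsFrom.1 hi).1 (mem_flowsFrom.1 hi).2.1)
        ((N.L_nonneg q' hE).trans (Network.L_le_cbsShaping hE ht.le))
  have hqE := (S.flow k).queues_sub hq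
  have hlinks : ∀ l ∈ N.inLinks q.src, 0 ≤ min (∑ q' ∈ N.linkQueues l,
      min (∑ i ∈ S.flowsFrom F q q', (S.flow i).curve (t + (S.flow i).deltaD q))
        (N.cbsShaping q' t)) (N.linkShaping q t) := fun l _ =>
    le_min (Finset.sum_nonneg (hfrom l))
      ((N.L_nonneg q hqE).trans (Network.L_le_linkShaping q ht.le))
  unfold improvedArrivalCurve
  rcases (S.flow k).pred_cases hq with ⟨-, hp⟩ | ⟨q', hq', -, -, hp⟩
  · refine (hkl.trans ?_).trans (le_add_of_nonneg_right (Finset.sum_nonneg hlinks))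
    exact Finset.single_le_sum (f := fun i => (S.flow i).curve (t + (S.flow i).deltaD q))
      (fun i hi => hcurve i (mem_localFlows.1 hi).1 (mem_localFlows.1 hi).2.1)
      (mem_localFlows.2 ⟨hk, hq, hp⟩)
  · have hE := (S.flow k).queues_sub hq'
    refine le_trans ?_ (le_add_of_nonneg_left hlocal)
    refine le_trans (le_min ?_ ?_)
      (Finset.single_le_sum hlinks ((S.flow k).mem_inLinks hq hp))
    · refine le_trans (le_min ?_ ?_) (Finset.single_le_sum (hfrom q'.link)
        (Network.mem_linkQueues.2 ⟨hE, rfl⟩))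
      · exact hkl.trans (Finset.single_le_sum
          (f := fun i => (S.flow i).curve (t + (S.flow i).deltaD q))
          (fun i hi => hcurve i (mem_flowsFrom.1 hi).1 (mem_flowsFrom.1 hi).2.1)
          (mem_flowsFrom.2 ⟨hk, hq, hp⟩))
      · exact ((S.flow k).l_le.trans ((S.flow k).size_le q' hq')).trans
          (Network.L_le_cbsShaping hE ht.le)
    · exact ((S.flow k).l_le.trans ((S.flow k).size_le q hq)).trans
        (Network.L_le_linkShaping q ht.le)

/-- The admission control ensures that the delay budgets exceed the minimum latencies, so that no
flow curve is evaluated at a negative time. Since the arrival curve of the first `k + 1` flows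
contains the packets of flow `k`, the delay bound is at least the transmission time of the
smallest one. -/
theorem deltaD_nonneg {α : Finset (Fin n) → Queue V Q → ℝ → ℝ}
    (hα : ∀ F q t, S.improvedArrivalCurve F q t ≤ α F q t) (hadm : S.Admitted α) (k : Fin n) :
    ∀ q ∈ (S.flow k).queues, 0 ≤ (S.flow k).deltaD q ∨ (S.flow k).MIF = 0 := by
  induction k using WellFoundedLT.induction with
  | ind k ih =>
  by_cases hMIF : (S.flow k).MIF = 0
  · exact fun _ _ => Or.inr hMIF
  intro q hq
  refine Or.inl ?_
  obtain ⟨m, hm⟩ : ∃ m, ((S.flow k).before q).length = m := ⟨_, rfl⟩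
  induction m using Nat.strong_induction_on generalizing q with
  | _ m ihm =>
    rcases (S.flow k).pred_cases hq with ⟨hb, -⟩ | ⟨q', hq', -, hb, -⟩
    · simp [Flow.deltaD, Flow.accMax, Flow.accMin, hb]
    · have hΔ' := ihm _ (by rw [← hm, hb]; simp) q' hq' rfl
      have hE := (S.flow k).queues_sub hq'
      have hD := N.Dmax_nonneg q' hE
      have hle := le_of_horizontalDistance_le (Network.continuous_serviceCurve q')
        (Network.monotone_serviceCurve hE) hD (hadm k q' hq') le_rfl (c := (S.flow k).l)
        fun ε hε => by
          refine (l_le_improvedArrivalCurve (k := k) (by simp [first]) hq' hMIF ?_ ?_).trans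
            (hα _ _ _)
          · intro i hi hiq
            have hik : i ≤ k := by
              simp only [first, Finset.mem_filter, Finset.mem_univ, true_and] at hi
              exact Fin.le_def.2 (by omega)
            rcases hik.eq_or_lt with rfl | hik
            · exact Or.inl hΔ'
            · exact ih i hik q' hiq
          · linarith
      rw [zero_add] at hle
      have := (div_le_iff₀' N.C_pos).2 (hle.trans (Network.serviceCurve_le hE hD))
      rw [Flow.deltaD_of_before hb]
      linarith

end Reservations

/-! ### Conformance of the arrivals -/

namespace Trace

theorem delay_le {x : P} {q : Queue V Q} {a d H : ℝ} (hd : X.Departs x q d)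
    (h : d ≤ a + H) : X.delay x q a ≤ ENNReal.ofReal H :=
  (iInf₂_le d hd).trans (ENNReal.ofReal_le_ofReal (by linarith))

namespace IsRun

variable (hX : X.IsRun)
include hX

/-- If the delay budgets were met before time `a`, then the packets of flow `i` that arrive at
queue `q` within the closed interval `[s, a]` were emitted within a half-open interval of length
`a - s + ε` plus the accumulated delay difference. -/
theorem sum_size_le_curve_deltaD {i : Fin n} {q : Queue V Q} {s a ε : ℝ} (hsa : s ≤ a)
    (hε : 0 < ε) (hΔ : 0 ≤ (S.flow i).deltaD q ∨ (S.flow i).MIF = 0)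
    (hD : ∀ y q' b, b < a → X.Arrives y q' b → ∃ d, X.Departs y q' d ∧ d ≤ b + N.Dmax q')
    (Y : Finset P) (hY : ∀ y ∈ Y, X.flowOf y = i ∧ ∃ b, X.Arrives y q b ∧ s ≤ b ∧ b ≤ a) :
    ∑ y ∈ Y, X.size y ≤ (S.flow i).curve (a - s + ε + (S.flow i).deltaD q) := by
  rcases hΔ with hΔ | hMIF
  · refine hX.sum_size_le_curve i Y (s := s - (S.flow i).accMax q) (by linarith) fun y hy => ?_
    obtain ⟨rfl, b, hb, hsb, hba⟩ := hY y hy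
    have h1 := hX.emit_add_accMin_le hb
    have h2 := hX.le_emit_add_accMax hb fun q' b' hb' h => hD y q' b' (hb'.trans_le hba) h
    refine ⟨rfl, by linarith, ?_⟩
    unfold Flow.deltaD
    linarith
  · have : Y = ∅ := by
      refine Finset.eq_empty_of_forall_notMem fun y hy => ?_
      have h := hX.emit_interval i (X.emit y)
      rw [hMIF, Nat.cast_zero, nonpos_iff_eq_zero, Set.encard_eq_zero] at h
      have : y ∈ (∅ : Set P) :=
        h ▸ ⟨(hY y hy).1, le_rfl, by linarith [(S.flow i).CMI_pos]⟩
      exact this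
    simp [this, Flow.curve, hMIF]

/-- If the delay budgets were met before time `a`, then the traffic that arrives at queue `q`
within the closed interval `[s, a]` conforms to the improved arrival curve. -/
theorem sum_size_le_improvedArrivalCurve {F : Finset (Fin n)} {q : Queue V Q} (hq : q ∈ N.E)
    {s a ε : ℝ} (hsa : s ≤ a) (hε : 0 < ε) (hF : S.reserved a ⊆ F)
    (hΔ : ∀ i, q ∈ (S.flow i).queues → 0 ≤ (S.flow i).deltaD q ∨ (S.flow i).MIF = 0)
    (hD : ∀ y q' b, b < a → X.Arrives y q' b → ∃ d, X.Departs y q' d ∧ d ≤ b + N.Dmax q')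
    (Y : Finset P) (hY : ∀ y ∈ Y, ∃ b, X.Arrives y q b ∧ s ≤ b ∧ b ≤ a) :
    ∑ y ∈ Y, X.size y ≤ S.improvedArrivalCurve F q (a - s + ε) := by
  have hqY : ∀ y ∈ Y, X.flowOf y ∈ F ∧ q ∈ (S.flow (X.flowOf y)).queues := fun y hy => by
    obtain ⟨b, hb, -, hba⟩ := hY y hy
    refine ⟨hF ?_, hb.1⟩
    simp only [Reservations.reserved, Finset.mem_filter, Finset.mem_univ, true_and]
    exact (hX.emit_reserved y).trans ((hX.emit_le_of_arrives hb).trans hba)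
  have hflows : ∀ (G : Finset (Fin n)) (Z : Finset P), Z ⊆ Y → (∀ y ∈ Z, X.flowOf y ∈ G) →
      (∀ i ∈ G, q ∈ (S.flow i).queues) →
      ∑ y ∈ Z, X.size y ≤ ∑ i ∈ G, (S.flow i).curve (a - s + ε + (S.flow i).deltaD q) := by
    intro G Z hZ hG hGq
    rw [← Finset.sum_fiberwise_of_maps_to hG]
    refine Finset.sum_le_sum fun i hi =>
      hX.sum_size_le_curve_deltaD hsa hε (hΔ i (hGq i hi)) hD _ fun y hy => ?_
    exact ⟨(Finset.mem_filter.1 hy).2, hY y (hZ (Finset.mem_filter.1 hy).1)⟩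
  have hdep : ∀ y ∈ Y, ∀ q', (S.flow (X.flowOf y)).pred q = some q' →
      ∃ d, X.Departs y q' d ∧ s ≤ d ∧ d ≤ a := fun y hy q' hp => by
    obtain ⟨b, ⟨-, h⟩, hsb, hba⟩ := hY y hy
    rcases h with ⟨hp', -⟩ | ⟨p, hp', hd⟩
    · simp [hp] at hp'
    · obtain rfl : q' = p := Option.some.inj (hp.symm.trans hp')
      exact ⟨b, hd, hsb, hba⟩
  have hmaps : ∀ y ∈ Y, ((S.flow (X.flowOf y)).pred q).map Queue.link ∈
      (N.inLinks q.src).insertNone := fun y hy => by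
    rcases hp : (S.flow (X.flowOf y)).pred q with _ | q'
    · simp
    · simpa using Flow.mem_inLinks (hqY y hy).2 hp
  rw [← Finset.sum_fiberwise_of_maps_to hmaps, Finset.sum_insertNone]
  refine add_le_add ?_ (Finset.sum_le_sum fun l _ => le_min ?_ ?_)
  · refine hflows _ _ (Finset.filter_subset _ _) (fun y hy => ?_)
      fun i hi => (Reservations.mem_localFlows.1 hi).2.1
    obtain ⟨hy, hp⟩ := Finset.mem_filter.1 hy
    exact Reservations.mem_localFlows.2
      ⟨(hqY y hy).1, (hqY y hy).2, Option.map_eq_none_iff.1 hp⟩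
  · have hmaps' : ∀ y ∈ Y.filter fun y =>
        ((S.flow (X.flowOf y)).pred q).map Queue.link = some l,
        (S.flow (X.flowOf y)).pred q ∈ (N.linkQueues l).map Function.Embedding.some := by
      intro y hy
      obtain ⟨hy, hl⟩ := Finset.mem_filter.1 hy
      obtain ⟨q', hp, hl⟩ := Option.map_eq_some_iff.1 hl
      have := Flow.of_pred_eq_some _ (hqY y hy).2 hp
      exact Finset.mem_map.2
        ⟨q', Network.mem_linkQueues.2 ⟨Flow.queues_sub _ this.1, hl⟩, hp.symm⟩
    rw [← Finset.sum_fiberwise_of_maps_to hmaps', Finset.sum_map]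
    refine Finset.sum_le_sum fun q' hq' => le_min ?_ ?_
    · refine hflows _ _ ((Finset.filter_subset _ _).trans (Finset.filter_subset _ _))
        (fun y hy => ?_) fun i hi => (Reservations.mem_flowsFrom.1 hi).2.1
      obtain ⟨hy, hp⟩ := Finset.mem_filter.1 hy
      have hy := (Finset.mem_filter.1 hy).1
      exact Reservations.mem_flowsFrom.2 ⟨(hqY y hy).1, (hqY y hy).2, hp⟩
    · have hE := (Network.mem_linkQueues.1 hq').1
      refine (hX.sum_size_le_cbsShaping hE _ hsa fun y hy => ?_).trans
        (Network.cbsShaping_mono hE (by linarith))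
      obtain ⟨hy, hp⟩ := Finset.mem_filter.1 hy
      exact hdep y (Finset.mem_filter.1 hy).1 q' hp
  · refine (hX.sum_size_le_linkShaping hq (l := l) _ hsa fun y hy => ?_).trans
      (Network.linkShaping_mono q (by linarith))
    obtain ⟨hy, hl⟩ := Finset.mem_filter.1 hy
    obtain ⟨q', hp, hl⟩ := Option.map_eq_some_iff.1 hl
    obtain ⟨d, hd⟩ := hdep y hy q' hp
    exact ⟨(hqY y hy).2, q', d, hl, hd⟩

/-! ### Delay bounds -/

/-- If the delay budgets were met before time `a`, then the delay of a packet that arrives at time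
`a` is bounded by the horizontal distance for the flows reserved at that time. -/
theorem exists_departs_le_of_horizontalDistance_le {α : Finset (Fin n) → Queue V Q → ℝ → ℝ}
    (hα : ∀ F q t, S.improvedArrivalCurve F q t ≤ α F q t) (hadm : S.Admitted α)
    {x : P} {q : Queue V Q} {a H : ℝ} (hx : X.Arrives x q a) (hH : 0 ≤ H)
    (hD : ∀ y q' b, b < a → X.Arrives y q' b → ∃ d, X.Departs y q' d ∧ d ≤ b + N.Dmax q')
    (h : horizontalDistance (α (S.reserved a) q) (N.serviceCurve q) ≤ ENNReal.ofReal H) :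
    ∃ d, X.Departs x q d ∧ d ≤ a + H := by
  have hq : q ∈ N.E := Flow.queues_sub _ hx.1
  refine hX.exists_departs_le hq hx hH fun s _ hsa Y hY => ?_
  refine le_of_horizontalDistance_le (Network.continuous_serviceCurve q)
    (Network.monotone_serviceCurve hq) hH h (by linarith) fun ε hε => ?_
  exact (hX.sum_size_le_improvedArrivalCurve hq hsa hε subset_rfl
    (fun i hi => Reservations.deltaD_nonneg hα hadm i q hi) hD Y hY).trans (hα _ _ _)

/-- While a flow through `q` is reserved, the bound at `q` is the one that was checked when the
last of the reserved flows through `q` was admitted. -/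
theorem horizontalDistance_reserved_le {α : Finset (Fin n) → Queue V Q → ℝ → ℝ}
    (hα : ∀ F G q, (∀ i, q ∈ (S.flow i).queues → (i ∈ F ↔ i ∈ G)) → α F q = α G q)
    (hadm : S.Admitted α) {x : P} {q : Queue V Q} {a : ℝ} (hx : X.Arrives x q a) :
    horizontalDistance (α (S.reserved a) q) (N.serviceCurve q) ≤ ENNReal.ofReal (N.Dmax q) := by
  have hmem : ∀ i, i ∈ S.reserved a ↔ S.time i ≤ a := fun i => by simp [Reservations.reserved]
  set G := (S.reserved a).filter fun i => q ∈ (S.flow i).queues with hG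
  have hne : G.Nonempty := ⟨X.flowOf x, Finset.mem_filter.2 ⟨(hmem _).2
    ((hX.emit_reserved x).trans (hX.emit_le_of_arrives hx)), hx.1⟩⟩
  obtain ⟨hja, hjq⟩ := Finset.mem_filter.1 (G.max'_mem hne)
  rw [hα (S.reserved a) (Reservations.first n (G.max' hne + 1)) q fun i hi => ?_]
  · exact hadm _ q hjq
  · simp only [hmem, Reservations.first, Finset.mem_filter, Finset.mem_univ, true_and,
      Nat.lt_succ_iff]
    constructor
    · intro hia
      exact Fin.le_def.1 (G.le_max' i (Finset.mem_filter.2 ⟨(hmem i).2 hia, hi⟩))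
    · intro hij
      exact (S.time_mono (Fin.le_def.2 hij)).trans ((hmem _).1 hja)

/-- The delay budgets are met: otherwise there would be a first arrival whose budget is violated,
as only finitely many arrivals precede it. -/
theorem exists_departs_le_Dmax {α : Finset (Fin n) → Queue V Q → ℝ → ℝ}
    (hle : ∀ F q t, S.improvedArrivalCurve F q t ≤ α F q t)
    (hα : ∀ F G q, (∀ i, q ∈ (S.flow i).queues → (i ∈ F ↔ i ∈ G)) → α F q = α G q)
    (hadm : S.Admitted α) {x : P} {q : Queue V Q} {a : ℝ} (hx : X.Arrives x q a) :
    ∃ d, X.Departs x q d ∧ d ≤ a + N.Dmax q := by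
  have hfin : ∀ a : ℝ, {b | b < a ∧ ∃ y p, X.Arrives y p b}.Finite := fun a => by
    refine (N.E.finite_toSet.biUnion fun p _ => hX.finite_events p a).subset ?_
    rintro b ⟨hba, y, p, hb⟩
    exact Set.mem_biUnion (Flow.queues_sub _ hb.1) ⟨⟨y, Or.inl hb⟩, hba.le⟩
  obtain ⟨m, hm⟩ : ∃ m, {b | b < a ∧ ∃ y p, X.Arrives y p b}.ncard = m := ⟨_, rfl⟩
  induction m using Nat.strong_induction_on generalizing x q a with
  | _ m ih =>
    refine hX.exists_departs_le_of_horizontalDistance_le hle hadm hx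
      (N.Dmax_nonneg q (Flow.queues_sub _ hx.1)) (fun y p b hba hy => ?_)
      (hX.horizontalDistance_reserved_le hα hadm hx)
    refine ih _ ?_ hy rfl
    rw [← hm]
    refine Set.ncard_lt_ncard ⟨fun c hc => ⟨hc.1.trans hba, hc.2⟩, fun h => ?_⟩ (hfin a)
    exact lt_irrefl b (h ⟨hba, y, p, hy⟩).1

end IsRun
end Trace

end RRP

theorem mainTheorem3 {V : Type*} [DecidableEq V] {Q : ℕ} (N : RRP.Network V Q) {n : ℕ}
    (S : RRP.Reservations N n) {P : Type*} (X : RRP.Trace S P) (hX : X.IsRun)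
    (α : Finset (Fin n) → RRP.Queue V Q → ℝ → ℝ)
    (hα : α = S.arrivalCurve ∨ α = S.improvedArrivalCurve) (hadm : S.Admitted α) :
    (∀ k ≤ n, ∀ q ∈ N.E,
      X.worstDelay k q ≤
        RRP.horizontalDistance (α (RRP.Reservations.first n k) q) (N.serviceCurve q) ∧
      X.worstDelay k q ≤ ENNReal.ofReal (N.Dmax q)) ∧
    (∀ k : Fin n, ∀ q ∈ N.E, q ∉ (S.flow k).queues →
      α (RRP.Reservations.first n (k + 1)) q = α (RRP.Reservations.first n k) q) := by
  have hle : ∀ F q t, S.improvedArrivalCurve F q t ≤ α F q t := by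
    rcases hα with rfl | rfl
    · exact RRP.Reservations.improvedArrivalCurve_le_arrivalCurve
    · exact fun _ _ _ => le_rfl
  have hcongr : ∀ F G q, (∀ i, q ∈ (S.flow i).queues → (i ∈ F ↔ i ∈ G)) → α F q = α G q := by
    intro F G q h
    rcases hα with rfl | rfl
    · exact (RRP.Reservations.arrivalCurve_congr h).1
    · exact (RRP.Reservations.arrivalCurve_congr h).2
  refine ⟨fun k _ q _ => ⟨iSup_le fun x => iSup_le fun a => iSup_le fun ⟨hx, hk⟩ => ?_,
    iSup_le fun x => iSup_le fun a => iSup_le fun ⟨hx, _⟩ => ?_⟩, fun k q _ hkq => ?_⟩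
  · have hfin := ((hX.horizontalDistance_reserved_le hcongr hadm hx).trans_lt
      ENNReal.ofReal_lt_top).ne
    obtain ⟨d, hd, hda⟩ := hX.exists_departs_le_of_horizontalDistance_le hle hadm hx
      ENNReal.toReal_nonneg (fun y p b _ hy => hX.exists_departs_le_Dmax hle hcongr hadm hy)
      (ENNReal.ofReal_toReal hfin).ge
    rw [← hk, ← ENNReal.ofReal_toReal hfin]
    exact RRP.Trace.delay_le hd hda
  · obtain ⟨d, hd, hda⟩ := hX.exists_departs_le_Dmax hle hcongr hadm hx
    exact RRP.Trace.delay_le hd hda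
  · refine hcongr _ _ q fun i hi => ?_
    have hik : i ≠ k := by
      rintro rfl
      exact hkq hi
    have := Fin.val_ne_of_ne hik
    simp only [RRP.Reservations.first, Finset.mem_filter, Finset.mem_univ, true_and]
    omega
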